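/- Let $\mathcal F$ be a nonprincipal ultrafilter on $\mathbf N$, let $1\le\nu\le\omega$ ($\nu$ a natural number or $\nu=\omega$), and let $\langle G_n^\nu\rangle$ be a sequence of transfinite graphs of rank $\nu$ in Zemanian's sense: branches are pairs of distinct 0-nodes; for each rank $\alpha<\nu$ (natural, or $\vec\omega$ when $\nu=\omega$) the $\alpha$-tips, i.e. the classes of one-ended $\alpha$-paths that agree from some point on, are partitioned among the nodes of the next rank ($\omega$ after $\vec\omega$); each node of positive rank contains at least one such tip and at most one exceptional element (a node of lower rank), a node is the exceptional element of at most one node, and there are no $\vec\omega$-nodes. Turn each $G_n^\nu$ into a network ${\bf N}_n^\nu$ by giving each (oriented) branch $b$ a resistance $r_b>0$ in series with a voltage source $e_b\in\mathbf R$, and suppose that $\sum_b e_b^2/r_b<\infty$ for almost all $n$ (modulo $\mathcal F$). A loop is perceptible if its resistances have a finite sum. Let ${\cal L}_n$ be the closure, in the Hilbert space of the branch-current vectors of ${\bf N}_n^\nu$ with $\sum_b r_b i_b^2<\infty$, of the span of the unit currents around the perceptible loops of ranks up to $\nu$. Let ${}^*{\bf N}^\nu$ be the nonstandard network induced by $\langle{\bf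 N}_n^\nu\rangle$, and let ${}^*{\cal L}$ be the set of hyperreal current vectors ${\bf s}=[s_n]$ with $s_n\in{\cal L}_n$ for almost all $n$. Nonstandard sums $\sum_{\bf b}{\bf a}_{\bf b}$ with ${\bf a}=[a_n]$ are the hyperreals $[\sum_b a_n(b)]$. An operating point is a pair ${\bf i},{\bf v}$ of hyperreal branch vectors with ${\bf i}\in{}^*{\cal L}$, with Ohm's law ${\bf v}={\bf r}{\bf i}-{\bf e}$ in every branch, and with Tellegen's equation $\sum{\bf r}_{\bf b}{\bf i}_{\bf b}{\bf s}_{\bf b}=\sum{\bf e}_{\bf b}{\bf s}_{\bf b}$ for all ${\bf s}\in{}^*{\cal L}$. Then ${}^*{\bf N}^\nu$ has exactly one operating point, and it satisfies the nonstandard Kirchhoff laws, the sums below being absolutely convergent for almost all $n$: (a) Current law. If ${\bf x}^0=[x_n^0]$ is a nonstandard 0-node such that, for almost all $n$, $x_n^0$ is maximal (not embraced by a node of higher rank) and restraining ($\sum 1/r_b<\infty$ over the branches incident to $x_n^0$), then $\sum\pm{\bf i}_{\bf b}=0$ over the nonstandard branches incident to ${\bf x}^0$, where the sign is $+$ (resp.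 $-$) if ${\bf b}$ is oriented away from (resp. towards) ${\bf x}^0$. For a nonstandard node ${\bf x}^\mu$ of rank $1\le\mu\le\nu$, the law holds for every restraining cut around it: let ${\bf S}=[S_n]$ be an internal set of nodes to which ${\bf x}^\mu$ belongs such that, for almost all $n$, (i) if one node embraces another, then both or neither are in $S_n$, (ii) the nodes of a one-ended path of rank below $\nu$ are, from some point on, on the same side (in $S_n$ or not) as the node containing its tip, and (iii) $\sum 1/r_b<\infty$ over the branches with exactly one 0-node in $S_n$; then $\sum\pm{\bf i}_{\bf b}=0$ over the nonstandard branches leading from ${\bf S}$ to its complement. (b) Voltage law. If ${\bf L}=[L_n]$ is a nonstandard loop such that, for almost all $n$, $L_n$ is a perceptible loop of rank at most $\nu$, then $\sum\pm{\bf v}_{\bf b}=0$ over the branches of ${\bf L}$, where the sign is $+$ (resp. $-$) if the orientations of ${\bf b}$ and ${\bf L}$ agree (resp. disagree). -/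

import Mathlib

open Filter

universe u v w

/-! ### Transfinite paths as data

Ranks live in `ℕ∞`.  A *node* has rank `0, 1, 2, …` or `ω`, and `⊤` is read as `ω`.
A *path* or a *tip* has rank `0, 1, 2, …` or `ω⃗` (the arrow rank, just below `ω`), and `⊤` is read
as `ω⃗`.  The tips of rank `α` are contained in nodes of rank `α + 1`; since `⊤ + 1 = ⊤`, this covers
`ω⃗`-tips and `ω`-nodes.  "A path of rank `α` is of lower rank than a node of rank `β`" is
`α + 1 ≤ β`; since `⊤ + 1 = ⊤`, this lets paths of rank `ω⃗` lie between `ω`-nodes. -/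

/-- An alternating sequence `…, x m, P m, x (m + 1), P (m + 1), …` of nodes and of paths of lower
rank, traversed in the direction of increasing `m`.  The nodes are the `x m` with `lo ≤ m ≤ hi`, and
`P m` is present when `m` and `m + 1` are both in that range; `none` as a bound means that the
sequence does not terminate on that side.  `edge` stands for a single branch, between the two
adjacent nodes.  Entries outside the range are irrelevant. -/
inductive RawPath (V : Type u) : Type u
  | edge : RawPath V
  | seq (lo hi : Option ℤ) (x : ℤ → V) (P : ℤ → RawPath V) : RawPath V

/-- `m` lies between the (possibly absent) bounds `lo` and `hi`. -/
def InRange (lo hi : Option ℤ) (m : ℤ) : Prop :=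
  (∀ a ∈ lo, a ≤ m) ∧ (∀ b ∈ hi, m ≤ b)

/-- `m` indexes a constituent path, between the nodes `m` and `m + 1`. -/
def InGaps (lo hi : Option ℤ) (m : ℤ) : Prop :=
  InRange lo hi m ∧ InRange lo hi (m + 1)

/-- `m` indexes a nonterminal node. -/
def Interior (lo hi : Option ℤ) (m : ℤ) : Prop :=
  InRange lo hi (m - 1) ∧ InRange lo hi m ∧ InRange lo hi (m + 1)

namespace RawPath

variable {V : Type u}

/-- The path traversed backwards. -/
def reverse : RawPath V → RawPath V
  | edge => edge
  | seq lo hi x P =>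
      seq (hi.map fun b => -b) (lo.map fun a => -a) (fun m => x (-m)) (fun m => (P (-m - 1)).reverse)

/-- The set of all nodes that occur in the path or, recursively, in its constituent paths. -/
def nodes : RawPath V → Set V
  | edge => ∅
  | seq lo hi x P =>
      {y | ∃ m, InRange lo hi m ∧ y = x m} ∪ {y | ∃ m, InGaps lo hi m ∧ y ∈ (P m).nodes}

/-- The branches of the path, each written as the ordered pair of its 0-nodes in the direction in
which the path traverses it. -/
def darts : RawPath V → Set (V × V)
  | edge => ∅
  | seq lo hi x P =>
      {d | ∃ m, InGaps lo hi m ∧ P m = edge ∧ d = (x m, x (m + 1))} ∪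
        {d | ∃ m, InGaps lo hi m ∧ d ∈ (P m).darts}

/-- The part of the path from its `m`th node onwards. -/
def tailAt : RawPath V → ℤ → RawPath V
  | edge, _ => edge
  | seq _ hi x P, m => seq (some m) hi x P

/-- `m` is the index of a node of the path. -/
def HasIndex : RawPath V → ℤ → Prop
  | edge, _ => False
  | seq lo hi _ _, m => InRange lo hi m

/-- One-ended: the sequence has a first node and no last one. -/
def OneEnded : RawPath V → Prop
  | edge => False
  | seq lo hi _ _ => lo ≠ none ∧ hi = none

/-- The terminal node on the right, if the sequence terminates there. -/
def rightNode : RawPath V → Option V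
  | edge => none
  | seq _ hi x _ => hi.map x

/-- A one-ended path that represents the right-hand tip, if the sequence does not terminate on the
right. -/
def rightRay : RawPath V → Option (RawPath V)
  | seq lo none x P => some (seq (some (lo.getD 0)) none x P)
  | _ => none

/-- The terminal node on the left, if there is one. -/
def leftNode (p : RawPath V) : Option V := p.reverse.rightNode

/-- A one-ended path that represents the left-hand tip, if the sequence does not terminate on the
left. -/
def leftRay (p : RawPath V) : Option (RawPath V) := p.reverse.rightRay

/-- Two one-ended paths agree from some point on. -/
def CommonTail (p q : RawPath V) : Prop :=
  ∃ m m', p.HasIndex m ∧ q.HasIndex m' ∧ (p.tailAt m).darts = (q.tailAt m').darts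

end RawPath

/-- A closed alternating sequence `x 0, P 0, x 1, …, x (len - 1), P (len - 1), x 0`. -/
structure RawLoop (V : Type u) : Type u where
  len : ℕ
  x : ℕ → V
  P : ℕ → RawPath V

namespace RawLoop

variable {V : Type u}

/-- The node that follows `P m`. -/
def next (L : RawLoop V) (m : ℕ) : V := L.x ((m + 1) % L.len)

/-- The constituent path that precedes `x m`. -/
def prev (L : RawLoop V) (m : ℕ) : RawPath V := L.P ((m + (L.len - 1)) % L.len)

/-- The branches of the loop, as ordered pairs in the direction of the loop. -/
def darts (L : RawLoop V) : Set (V × V) :=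
  {d | ∃ m < L.len, L.P m = RawPath.edge ∧ d = (L.x m, L.next m)} ∪
    {d | ∃ m < L.len, d ∈ (L.P m).darts}

end RawLoop

/-! ### Transfinite graphs -/

/-- The data of a transfinite graph: a set `V` of nodes of all ranks; the branches, which are pairs of
distinct 0-nodes; for each (one-ended path representing a) tip, the node that contains it; and for
each node its exceptional element, if it has one. -/
structure TransfiniteData (V : Type u) where
  rank : V → ℕ∞
  branches : SimpleGraph V
  tipNode : RawPath V → V
  exc : V → Option V

namespace TransfiniteData

variable {V : Type u} (G : TransfiniteData V)

/-- `x` embraces `y`: `y` is `x`, or the exceptional element of `x`, or the exceptional element of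
that one, and so on. -/
def Embraces : V → V → Prop :=
  Relation.ReflTransGen fun x y => G.exc x = some y

/-- Two nodes meet when one of them embraces the other. -/
def Meets (x y : V) : Prop := G.Embraces x y ∨ G.Embraces y x

/-- No node of the first set meets a node of the second set. -/
def TotallyDisjoint (A B : Set V) : Prop := ∀ x ∈ A, ∀ y ∈ B, ¬ G.Meets x y

/-- The node that contains the right-hand tip, if there is one. -/
def rightTipNode (p : RawPath V) : Option V := p.rightRay.map G.tipNode

/-- The node that contains the left-hand tip, if there is one. -/
def leftTipNode (p : RawPath V) : Option V := p.leftRay.map G.tipNode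

/-- The path reaches the node `z` on the right: through a terminal node embraced by `z`, or through a
tip contained in `z` or in a node embraced by `z`. -/
def ReachesRight (p : RawPath V) (z : V) : Prop :=
  ∃ t, (p.rightNode = some t ∨ G.rightTipNode p = some t) ∧ G.Embraces z t

/-- The path reaches the node `z` on the left. -/
def ReachesLeft (p : RawPath V) (z : V) : Prop :=
  ∃ t, (p.leftNode = some t ∨ G.leftTipNode p = some t) ∧ G.Embraces z t

/-- Except possibly at a terminal node of `p`, the path `p` does not meet the node `z`. -/
def MeetsOnlyTerminally (p : RawPath V) (z : V) : Prop :=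
  ∀ y ∈ p.nodes, G.Meets y z → ∃ t, (p.leftNode = some t ∨ p.rightNode = some t) ∧ G.Meets y t

/-- The elements of the alternating sequence that are not adjacent in it are totally disjoint. -/
def SeqDisjoint (lo hi : Option ℤ) (x : ℤ → V) (P : ℤ → RawPath V) : Prop :=
  (∀ i j, InRange lo hi i → InRange lo hi j → i ≠ j → ¬ G.Meets (x i) (x j)) ∧
  (∀ i j, InGaps lo hi i → InGaps lo hi j → i ≠ j → G.TotallyDisjoint (P i).nodes (P j).nodes) ∧
  (∀ i j, InRange lo hi i → InGaps lo hi j → i ≠ j → i ≠ j + 1 →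
    G.TotallyDisjoint {x i} (P j).nodes)

/-- Each constituent path reaches its two adjacent nodes and otherwise does not meet them, and each
nonterminal node is reached by at least one of the two adjacent paths through a tip that this node
itself contains. -/
def SeqLinked (lo hi : Option ℤ) (x : ℤ → V) (P : ℤ → RawPath V) : Prop :=
  (∀ m, InGaps lo hi m →
    G.ReachesLeft (P m) (x m) ∧ G.ReachesRight (P m) (x (m + 1)) ∧
    G.MeetsOnlyTerminally (P m) (x m) ∧ G.MeetsOnlyTerminally (P m) (x (m + 1))) ∧
  (∀ m, Interior lo hi m →
    G.rightTipNode (P (m - 1)) = some (x m) ∨ G.leftTipNode (P m) = some (x m))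

/-- `G.IsPath p α`: `p` is a nontrivial path of rank `α`, where `⊤` is the rank `ω⃗`.
* Rank `0`: an alternating sequence of 0-nodes and branches.
* Natural rank `α > 0`: the nonterminal nodes have rank `α`, the terminal nodes have rank at most
  `α`, and the constituent paths have ranks less than `α`.
* Rank `ω⃗`: the sequence does not terminate on at least one side, the nodes have natural-number ranks
  that increase strictly towards each end at which it does not terminate (after possibly finitely many
  terms), and the rank of each constituent path is less than the larger of the ranks of its two
  adjacent nodes. -/
def IsPath : RawPath V → ℕ∞ → Prop
  | .edge, _ => False
  | .seq lo hi x P, α =>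
    (∃ m, InGaps lo hi m) ∧
    G.SeqDisjoint lo hi x P ∧
    ((α = 0 ∧ ∀ m, InGaps lo hi m → P m = .edge ∧ G.branches.Adj (x m) (x (m + 1))) ∨
     (0 < α ∧ α < ⊤ ∧ G.SeqLinked lo hi x P ∧
      (∀ m, InRange lo hi m → G.rank (x m) ≤ α) ∧
      (∀ m, Interior lo hi m → G.rank (x m) = α) ∧
      (∀ m, InGaps lo hi m → ∃ β, β + 1 ≤ α ∧ IsPath (P m) β)) ∨
     (α = ⊤ ∧ (lo = none ∨ hi = none) ∧ G.SeqLinked lo hi x P ∧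
      (∀ m, InRange lo hi m → G.rank (x m) < ⊤) ∧
      (∃ c, InRange lo hi c ∧
        (∀ i j, InRange lo hi i → InRange lo hi j → c ≤ i → i < j → G.rank (x i) < G.rank (x j)) ∧
        (∀ i j, InRange lo hi i → InRange lo hi j → i < j → j ≤ c → G.rank (x j) < G.rank (x i))) ∧
      (∀ m, InGaps lo hi m →
        ∃ β, β + 1 ≤ max (G.rank (x m)) (G.rank (x (m + 1))) ∧ IsPath (P m) β)))

/-- A one-ended path of rank `α`, i.e. a representative of an `α`-tip. -/
def IsRay (p : RawPath V) (α : ℕ∞) : Prop := p.OneEnded ∧ G.IsPath p α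

/-- `L` is a loop of rank `β` (here `⊤` is the rank `ω`): for `β = 0`, a cycle of 0-nodes and
branches; for `β > 0`, a closed alternating sequence of nodes of rank `β` and of paths of lower
rank, subject to the conditions on a path of rank `β`, read cyclically. -/
def IsLoop (L : RawLoop V) (β : ℕ∞) : Prop :=
  (∀ i < L.len, ∀ j < L.len, i ≠ j → ¬ G.Meets (L.x i) (L.x j)) ∧
  ((β = 0 ∧ 3 ≤ L.len ∧
    ∀ m < L.len, L.P m = RawPath.edge ∧ G.branches.Adj (L.x m) (L.next m)) ∨
   (0 < β ∧ 1 ≤ L.len ∧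
    (∀ i < L.len, ∀ j < L.len, i ≠ j → G.TotallyDisjoint (L.P i).nodes (L.P j).nodes) ∧
    (∀ i < L.len, ∀ j < L.len, i ≠ j → i ≠ (j + 1) % L.len →
      G.TotallyDisjoint {L.x i} (L.P j).nodes) ∧
    (∀ m < L.len,
      G.rank (L.x m) = β ∧
      (∃ α, α + 1 ≤ β ∧ G.IsPath (L.P m) α) ∧
      G.ReachesLeft (L.P m) (L.x m) ∧ G.ReachesRight (L.P m) (L.next m) ∧
      G.MeetsOnlyTerminally (L.P m) (L.x m) ∧ G.MeetsOnlyTerminally (L.P m) (L.next m) ∧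
      (G.rightTipNode (L.prev m) = some (L.x m) ∨ G.leftTipNode (L.P m) = some (L.x m)))))

end TransfiniteData

/-- A transfinite graph of rank `ν` (`ν = ⊤` is the rank `ω`) with node set `V`. -/
structure TransfiniteGraph (V : Type u) (ν : ℕ∞) extends TransfiniteData V where
  rank_le : ∀ x, rank x ≤ ν
  /-- Branches join 0-nodes. -/
  rank_of_adj : ∀ x y, branches.Adj x y → rank x = 0
  /-- The `α`-tips, for ranks `α` below `ν`, are partitioned among the nodes of the next rank. -/
  rank_tipNode : ∀ α p, α + 1 ≤ ν → toTransfiniteData.IsRay p α → rank (tipNode p) = α + 1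
  /-- Equivalent one-ended paths represent the same tip. -/
  tipNode_congr : ∀ α p q, α + 1 ≤ ν → toTransfiniteData.IsRay p α → toTransfiniteData.IsRay q α →
    p.CommonTail q → tipNode p = tipNode q
  /-- Each node of positive rank contains at least one tip of the preceding rank. -/
  exists_tip : ∀ x, rank x ≠ 0 → ∃ α p, α + 1 = rank x ∧ toTransfiniteData.IsRay p α ∧ tipNode p = x
  /-- An exceptional element is a node of lower rank. -/
  rank_exc : ∀ x y, exc x = some y → rank y < rank x
  /-- A node is the exceptional element of at most one node. -/
  exc_inj : ∀ x x' y, exc x = some y → exc x' = some y → x = x'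
  /-- There is no `ω⃗`-node, i.e. no infinite sequence of nodes, each the exceptional element of the
  next. -/
  no_arrowNode : ¬ ∃ f : ℕ → V, ∀ k, exc (f (k + 1)) = some (f k)

namespace TransfiniteGraph

variable {V : Type u} {ν : ℕ∞} (G : TransfiniteGraph V ν)

/-- The branches of the graph. -/
abbrev Branch : Type u := G.branches.edgeSet

/-- `x` is not embraced by any other node. -/
def IsMaximal (x : V) : Prop := ∀ y, G.exc y ≠ some x

/-- Representatives of the tips that are contained in nodes of rank `μ`. -/
def RayBelow (μ : ℕ∞) : Type u :=
  {p : RawPath V // ∃ α, α + 1 = μ ∧ α + 1 ≤ ν ∧ G.IsRay p α}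

/-- The tips of the rank preceding `μ`: one-ended paths up to agreement from some point on. -/
def Tip (μ : ℕ∞) : Type u :=
  Quot fun p q : G.RayBelow μ => p.1.CommonTail q.1

/-- The node that contains a tip. -/
def Tip.node {μ : ℕ∞} : G.Tip μ → V :=
  Quot.lift (fun p => G.tipNode p.1) (by
    rintro ⟨p, α, h1, h2, h3⟩ ⟨q, β, h4, _, h6⟩ h
    have hab : β = α := by
      exact WithTop.add_right_cancel ENat.one_ne_top (h4.trans h1.symm)
    subst hab
    exact G.tipNode_congr β p q h2 h3 h6 h)

/-- The extremities that make up the nodes of rank `μ`: the tips of the preceding rank, and the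
exceptional elements of the nodes of rank `μ`. -/
inductive Extremity (μ : ℕ∞) : Type u
  | tip (t : G.Tip μ) : Extremity μ
  | exceptional (x y : V) (rank_eq : G.rank x = μ) (exc_eq : G.exc x = some y) : Extremity μ

/-- The node of rank `μ` to which an extremity belongs.  (An exceptional element belongs to just one
node, so that it may be stored together with it.) -/
def Extremity.node {μ : ℕ∞} : G.Extremity μ → V
  | .tip t => Tip.node G t
  | .exceptional x _ _ _ => x

/-- Two extremities are shorted together when they belong to the same node. -/
def Shorted {μ : ℕ∞} (e f : G.Extremity μ) : Prop :=
  Extremity.node G e = Extremity.node G f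

/-- `S` is one side of a cut: a set of nodes (of all ranks) that contains with a node all the nodes
that meet it, and such that the nodes of a one-ended path are, from some point on, on the same side
as the node that contains its tip. -/
def IsCutSide (S : Set V) : Prop :=
  (∀ x y, G.Embraces x y → (x ∈ S ↔ y ∈ S)) ∧
  (∀ α p, α + 1 ≤ ν → G.IsRay p α →
    ∃ m, p.HasIndex m ∧ ∀ y ∈ (p.tailAt m).nodes, (y ∈ S ↔ G.tipNode p ∈ S))

end TransfiniteGraph

/-! ### Electrical networks on transfinite graphs -/

/-- A resistive network on `G`.  Each branch is oriented from `tail` to `head`, and currents, voltages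
and sources are measured with respect to that orientation.  Each branch consists of a resistance
`r b > 0` in series with a voltage source `e b` (which is zero when there is no source). -/
structure ResistiveNetwork {V : Type u} {ν : ℕ∞} (G : TransfiniteGraph V ν) where
  tail : G.Branch → V
  head : G.Branch → V
  orient : ∀ b : G.Branch, (b : Sym2 V) = s(tail b, head b)
  r : G.Branch → ℝ
  e : G.Branch → ℝ
  r_pos : ∀ b, 0 < r b

namespace ResistiveNetwork

variable {V : Type u} {ν : ℕ∞} {G : TransfiniteGraph V ν} (N : ResistiveNetwork G)

/-- The total isolated power of the sources is finite. -/
def FiniteIsolatedPower : Prop := Summable fun b => N.e b ^ 2 / N.r b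

open Classical in
/-- The unit current around a loop: `1` (resp. `-1`) in the branches that the loop traverses along
(resp. against) their orientation, and `0` in all other branches. -/
noncomputable def loopCurrent (L : RawLoop V) (b : G.Branch) : ℝ :=
  (if (N.tail b, N.head b) ∈ L.darts then 1 else 0) -
    (if (N.head b, N.tail b) ∈ L.darts then 1 else 0)

/-- A loop, of any rank up to `ν`. -/
def IsLoop (_ : ResistiveNetwork G) (L : RawLoop V) : Prop := ∃ β, β ≤ ν ∧ G.IsLoop L β

/-- The sum of the resistances in the loop is finite. -/
def Perceptible (L : RawLoop V) : Prop := Summable fun b => |N.loopCurrent L b| * N.r b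

/-- The span of the unit currents around perceptible loops of ranks up to `ν`. -/
def loopSpan : Submodule ℝ (G.Branch → ℝ) :=
  Submodule.span ℝ {s | ∃ L, N.IsLoop L ∧ N.Perceptible L ∧ s = N.loopCurrent L}

/-- The solution space `𝓛`: the closure of `loopSpan` in the Hilbert space of the branch-current
vectors of finite power, with the norm `(∑ r_b i_b²)^(1/2)`. -/
def solutionSpace : Set (G.Branch → ℝ) :=
  {s | Summable (fun b => N.r b * s b ^ 2) ∧
    ∀ ε > 0, ∃ t ∈ N.loopSpan, ∑' b, N.r b * (s b - t b) ^ 2 < ε}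

open Classical in
/-- The incidence of a branch with a set `S` of nodes: `1` if it is directed out of `S`, `-1` if it is
directed into `S`, and `0` if its two 0-nodes are both in `S` or both outside `S`. -/
noncomputable def incidence (S : Set V) (b : G.Branch) : ℝ :=
  (if N.tail b ∈ S then 1 else 0) - (if N.head b ∈ S then 1 else 0)

/-- The sum of the conductances of the branches between `S` and its complement is finite. -/
def Restraining (S : Set V) : Prop := Summable fun b => |N.incidence S b| / N.r b

end ResistiveNetwork

/-! ### Ultraproducts -/

namespace Internal

variable {F : Ultrafilter ℕ} {A : ℕ → Type u} {B : ℕ → Type v} {C : ℕ → Type w}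

/-- The property `p n (a n)` holds for almost all `n`. -/
def Holds (p : ∀ n, A n → Prop) (a : (F : Filter ℕ).Product A) : Prop :=
  Quotient.liftOn a (fun a => ∀ᶠ n in (F : Filter ℕ), p n (a n)) (by
    intro a a' h
    exact propext (eventually_congr (Eventually.mono h fun n hn => by rw [hn])))

/-- The relation `p n (a n) (b n)` holds for almost all `n`. -/
def Holds₂ (p : ∀ n, A n → B n → Prop) (a : (F : Filter ℕ).Product A)
    (b : (F : Filter ℕ).Product B) : Prop :=
  Quotient.liftOn₂ a b (fun a b => ∀ᶠ n in (F : Filter ℕ), p n (a n) (b n)) (by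
    intro a b a' b' h h'
    exact propext (eventually_congr (Eventually.mono (Filter.Eventually.and h h') fun n hn => by
      rw [hn.1, hn.2])))

/-- The class of `[f n (a n)]`. -/
def map (f : ∀ n, A n → B n) (a : (F : Filter ℕ).Product A) : (F : Filter ℕ).Product B :=
  Quotient.map (fun a n => f n (a n)) (fun a a' h => Eventually.mono h fun n hn => by
    show f n (a n) = f n (a' n)
    rw [hn]) a

/-- The class of `[f n (a n) (b n)]`. -/
def map₂ (f : ∀ n, A n → B n → C n) (a : (F : Filter ℕ).Product A) (b : (F : Filter ℕ).Product B) :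
    (F : Filter ℕ).Product C :=
  Quotient.map₂ (fun a b n => f n (a n) (b n)) (fun a a' h b b' h' => by
    refine Eventually.mono (Filter.Eventually.and h h') fun n hn => ?_
    show f n (a n) (b n) = f n (a' n) (b' n)
    rw [hn.1, hn.2]) a b

/-- The value `[a n (b n)]` of an internal real-valued function `[a n]` at `[b n]`, a hyperreal. -/
def value (a : (F : Filter ℕ).Product fun n => A n → ℝ) (b : (F : Filter ℕ).Product A) :
    (F : Filter ℕ).Germ ℝ :=
  Quotient.liftOn₂ a b (fun a b => ((fun n => a n (b n) : ℕ → ℝ) : (F : Filter ℕ).Germ ℝ)) (by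
    intro a b a' b' h h'
    refine Filter.Germ.coe_eq.2 (Eventually.mono (Filter.Eventually.and h h') fun n hn => ?_)
    show a n (b n) = a' n (b' n)
    rw [hn.1, hn.2])

/-- The internal sum `[∑ b, a n b]` of an internal real-valued function, a hyperreal. -/
noncomputable def sum (a : (F : Filter ℕ).Product fun n => A n → ℝ) : (F : Filter ℕ).Germ ℝ :=
  Quotient.liftOn a (fun a => ((fun n => ∑' b, a n b : ℕ → ℝ) : (F : Filter ℕ).Germ ℝ)) (by
    intro a a' h
    refine Filter.Germ.coe_eq.2 (Eventually.mono h fun n hn => ?_)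
    show ∑' b, a n b = ∑' b, a' n b
    rw [hn])

/-- The internal sum of `a` converges (absolutely) and has the hyperreal value `c`. -/
def HasSum (a : (F : Filter ℕ).Product fun n => A n → ℝ) (c : (F : Filter ℕ).Germ ℝ) : Prop :=
  Holds (fun _ a => Summable a) a ∧ sum a = c

end Internal

/-! ### Nonstandard graphs and networks

`F` is the ultrafilter, and `G n`, `N n` are the given standard graphs and networks. -/

namespace Nonstandard

variable {V : ℕ → Type u} {ν : ℕ∞} (F : Ultrafilter ℕ) (G : ∀ n, TransfiniteGraph (V n) ν)

/-- Nonstandard branches. -/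
abbrev Branch : Type u := (F : Filter ℕ).Product fun n => (G n).Branch

/-- Internal hyperreal-valued functions of the nonstandard branches. -/
abbrev BranchVector : Type u := (F : Filter ℕ).Product fun n => (G n).Branch → ℝ

/-- Nonstandard extremities: sequences of extremities modulo almost everywhere equality. -/
abbrev Extremity (μ : ℕ∞) : Type u := (F : Filter ℕ).Product fun n => (G n).Extremity μ

/-- Nonstandard extremities `[e n]` and `[f n]` are shorted together when `e n` and `f n` are shorted
together for almost all `n`. -/
def shorting (μ : ℕ∞) : Setoid (Extremity F G μ) where
  r := Internal.Holds₂ fun n e f => (G n).Shorted e f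
  iseqv := by
    refine ⟨fun e => ?_, fun {e f} h => ?_, fun {e f g} h h' => ?_⟩
    · induction e using Quotient.inductionOn
      exact Eventually.of_forall fun n => rfl
    · induction e using Quotient.inductionOn
      induction f using Quotient.inductionOn
      exact Eventually.mono h fun n hn => Eq.symm hn
    · induction e using Quotient.inductionOn
      induction f using Quotient.inductionOn
      induction g using Quotient.inductionOn
      exact Eventually.mono (Filter.Eventually.and h h') fun n hn => Eq.trans hn.1 hn.2

/-- Nonstandard nodes of rank `μ`, `1 ≤ μ ≤ ν`: equivalence classes of nonstandard extremities under
shorting. -/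
def Node (μ : ℕ∞) : Type u := Quotient (shorting F G μ)

/-- The internal node `[x n]`, where `x n` is the node of rank `μ` to which the `n`th term of a
representing sequence of extremities belongs. -/
def Node.toInternal {μ : ℕ∞} (x : Node F G μ) : (F : Filter ℕ).Product V :=
  Quotient.lift (Internal.map fun n => TransfiniteGraph.Extremity.node (G n)) (by
    intro e f h
    induction e using Quotient.inductionOn
    induction f using Quotient.inductionOn
    exact Quotient.sound h) x

variable {G} (N : ∀ n, ResistiveNetwork (G n))

/-- The hyperreal branch resistances. -/
def resistance : BranchVector F G := Quotient.mk _ fun n => (N n).r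

/-- The hyperreal branch voltage sources. -/
def source : BranchVector F G := Quotient.mk _ fun n => (N n).e

variable {F}

/-- Branchwise multiplication. -/
def mul (a b : BranchVector F G) : BranchVector F G :=
  Internal.map₂ (fun _ a b => a * b) a b

/-- Branchwise subtraction. -/
def sub (a b : BranchVector F G) : BranchVector F G :=
  Internal.map₂ (fun _ a b => a - b) a b

/-- The nonstandard solution space `*𝓛`. -/
def solutionSpace : Set (BranchVector F G) :=
  {s | Internal.Holds (fun n s => s ∈ (N n).solutionSpace) s}

/-- `(i, v)` is a hyperreal operating point: the current vector `i` is in `*𝓛`, Ohm's law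
`v = r i - e` holds, and Tellegen's equation `∑ r i s = ∑ e s` holds for all `s` in `*𝓛`. -/
def IsOperatingPoint (i v : BranchVector F G) : Prop :=
  i ∈ solutionSpace N ∧
  v = sub (mul (resistance F N) i) (source F N) ∧
  ∀ s ∈ solutionSpace N,
    Internal.sum (mul (resistance F N) (mul i s)) = Internal.sum (mul (source F N) s)

/-- At an operating point Ohm's law holds in each nonstandard branch, as an equation between
hyperreals. -/
theorem IsOperatingPoint.ohm {i v : BranchVector F G} (h : IsOperatingPoint N i v)
    (b : Branch F G) :
    Internal.value v b =
      Internal.value (resistance F N) b * Internal.value i b - Internal.value (source F N) b := by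
  obtain ⟨-, rfl, -⟩ := h
  induction i using Quotient.inductionOn
  induction b using Quotient.inductionOn
  rfl

/-- The hyperreal branch vector of the incidences with an internal set `[S n]` of nodes. -/
noncomputable def incidence (S : (F : Filter ℕ).Product fun n => Set (V n)) : BranchVector F G :=
  Internal.map (fun n S => (N n).incidence S) S

/-- The nonstandard unit current `[loopCurrent (L n)]` around `[L n]`. -/
noncomputable def loopCurrent (L : (F : Filter ℕ).Product fun n => RawLoop (V n)) :
    BranchVector F G :=
  Internal.map (fun n L => (N n).loopCurrent L) L

/-- The hyperreal currents `i`, added with signs over the branches between the internal set `S` of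
nodes and its complement, have the sum zero. -/
def CurrentLaw (i : BranchVector F G) (S : (F : Filter ℕ).Product fun n => Set (V n)) : Prop :=
  Internal.HasSum (mul (incidence N S) i) 0

/-- The hyperreal voltages `v`, added with signs over the branches of the nonstandard loop `L`, have
the sum zero. -/
def VoltageLaw (v : BranchVector F G) (L : (F : Filter ℕ).Product fun n => RawLoop (V n)) : Prop :=
  Internal.HasSum (mul (loopCurrent N L) v) 0

end Nonstandard

/-! Passing to representing sequences reduces every assertion to one about almost all of the
standard networks, so the substance lies in a single network. Weighting each branch current by the
square root of the resistance identifies the currents of finite power with `ℓ²` (through `ofLp`),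
and the solution space with a closed subspace (`ofLp_mem_solutionSpace`). Coefficients `w` with `∑
w_b² / r_b < ∞` then define a bounded functional `∑ w_b i_b`, represented by a vector of `ℓ²`
(`exists_hasSum_mul_ofLp`).

For `w = e`, Tellegen's equation is solved by the orthogonal projection of the representing vector
onto that subspace (`exists_tellegen`); two solutions agree because their difference is an
admissible test vector (`eq_of_tellegen`). The voltage law is Tellegen's equation tested on the unit
current around a perceptible loop.

For the current law, `w` is the incidence with a restraining cut. The functional is bounded, so it
vanishes on the solution space once it vanishes on loop currents, and that is combinatorial
(`IsCutSide.hasSum_darts`): by induction on the nesting of constituent paths, the net flow of a path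
out of `S` is the difference of the indicators of `S` at its two ends. The condition on one-ended
paths confines the crossings to finitely many constituents, whose flows telescope; the condition on
embracing lets the end of a constituent be exchanged for the adjacent node. Around a loop the
telescoping sum is zero. A maximal 0-node is by itself one side of a cut (`isCutSide_singleton`). -/

/-! ### Reversal and truncation of paths -/

theorem InRange.of_between {lo hi : Option ℤ} {a b m : ℤ} (ha : InRange lo hi a)
    (hb : InRange lo hi b) (h1 : a ≤ m) (h2 : m ≤ b) : InRange lo hi m :=
  ⟨fun c hc => (ha.1 c hc).trans h1, fun c hc => h2.trans (hb.2 c hc)⟩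

theorem inRange_neg_iff {lo hi : Option ℤ} {m : ℤ} :
    InRange (hi.map fun b => -b) (lo.map fun a => -a) m ↔ InRange lo hi (-m) := by
  cases lo <;> cases hi <;> simp [InRange] <;> omega

/-- A gap is named by its left node, and negation turns the right node into the left one; hence the
shift by one, which nodes do not need. -/
theorem inGaps_neg_iff {lo hi : Option ℤ} {m : ℤ} :
    InGaps (hi.map fun b => -b) (lo.map fun a => -a) m ↔ InGaps lo hi (-m - 1) := by
  rw [InGaps, InGaps, inRange_neg_iff, inRange_neg_iff, and_comm,
    show -(m + 1) = -m - 1 by ring, show -m - 1 + 1 = -m by ring]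

theorem interior_neg_iff {lo hi : Option ℤ} {m : ℤ} :
    Interior (hi.map fun b => -b) (lo.map fun a => -a) m ↔ Interior lo hi (-m) := by
  rw [Interior, Interior, inRange_neg_iff, inRange_neg_iff, inRange_neg_iff,
    show -(m + 1) = -m - 1 by ring, show -(m - 1) = -m + 1 by ring]
  tauto

namespace RawPath

variable {V : Type u}

@[simp] theorem reverse_reverse (p : RawPath V) : p.reverse.reverse = p := by
  induction p with
  | edge => rfl
  | seq lo hi x P ih =>
    simp only [reverse, Option.map_map, neg_neg, seq.injEq]
    refine ⟨by cases lo <;> simp, by cases hi <;> simp, trivial, ?_⟩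
    funext m
    rw [show -(-m - 1) - 1 = m by ring]
    exact ih m

theorem nodes_reverse (p : RawPath V) : p.reverse.nodes = p.nodes := by
  induction p with
  | edge => rfl
  | seq lo hi x P ih =>
    simp only [reverse, nodes, inRange_neg_iff, inGaps_neg_iff, ih]
    congr 1
    · ext y
      constructor
      · rintro ⟨m, h, rfl⟩
        exact ⟨-m, h, rfl⟩
      · rintro ⟨m, h, rfl⟩
        exact ⟨-m, by rwa [neg_neg], by rw [neg_neg]⟩
    · ext y
      constructor
      · rintro ⟨m, h, hy⟩
        exact ⟨-m - 1, h, hy⟩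
      · rintro ⟨m, h, hy⟩
        refine ⟨-m - 1, ?_, ?_⟩ <;> rwa [show -(-m - 1) - 1 = m by ring]

@[simp] theorem leftNode_reverse (p : RawPath V) : p.reverse.leftNode = p.rightNode := by
  rw [leftNode, reverse_reverse]

@[simp] theorem rightNode_reverse (p : RawPath V) : p.reverse.rightNode = p.leftNode := rfl

theorem mem_nodes_of_mem_darts (p : RawPath V) :
    ∀ d ∈ p.darts, d.1 ∈ p.nodes ∧ d.2 ∈ p.nodes := by
  induction p with
  | edge => rintro d ⟨⟩
  | seq lo hi x P ih =>
    rintro d (⟨m, hm, -, rfl⟩ | ⟨m, hm, hd⟩)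
    · exact ⟨Or.inl ⟨m, hm.1, rfl⟩, Or.inl ⟨m + 1, hm.2, rfl⟩⟩
    · exact ⟨Or.inr ⟨m, hm, (ih m d hd).1⟩, Or.inr ⟨m, hm, (ih m d hd).2⟩⟩

end RawPath

namespace TransfiniteData

variable {V : Type u} (G : TransfiniteData V)

@[simp] theorem leftTipNode_reverse (p : RawPath V) :
    G.leftTipNode p.reverse = G.rightTipNode p := by
  rw [leftTipNode, rightTipNode, RawPath.leftRay, RawPath.reverse_reverse]

@[simp] theorem rightTipNode_reverse (p : RawPath V) :
    G.rightTipNode p.reverse = G.leftTipNode p := rfl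

theorem reachesLeft_reverse (p : RawPath V) (z : V) :
    G.ReachesLeft p.reverse z ↔ G.ReachesRight p z := by
  simp [ReachesLeft, ReachesRight]

theorem reachesRight_reverse (p : RawPath V) (z : V) :
    G.ReachesRight p.reverse z ↔ G.ReachesLeft p z := Iff.rfl

theorem meetsOnlyTerminally_reverse (p : RawPath V) (z : V) :
    G.MeetsOnlyTerminally p.reverse z ↔ G.MeetsOnlyTerminally p z := by
  simp only [MeetsOnlyTerminally, RawPath.nodes_reverse, RawPath.leftNode_reverse,
    RawPath.rightNode_reverse, or_comm]

theorem meets_refl (x : V) : G.Meets x x := Or.inl Relation.ReflTransGen.refl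

theorem TotallyDisjoint.disjoint {G : TransfiniteData V} {A B : Set V}
    (h : G.TotallyDisjoint A B) : Disjoint A B :=
  Set.disjoint_left.2 fun x hA hB => h x hA x hB (G.meets_refl x)

variable {G}

theorem SeqDisjoint.reverse {lo hi : Option ℤ} {x : ℤ → V} {P : ℤ → RawPath V}
    (h : G.SeqDisjoint lo hi x P) :
    G.SeqDisjoint (hi.map fun b => -b) (lo.map fun a => -a) (fun m => x (-m))
      (fun m => (P (-m - 1)).reverse) := by
  obtain ⟨h1, h2, h3⟩ := h
  simp only [SeqDisjoint, inRange_neg_iff, inGaps_neg_iff, RawPath.nodes_reverse]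
  refine ⟨fun i j hi hj hij => h1 _ _ hi hj (by omega),
    fun i j hi hj hij => h2 _ _ hi hj (by omega),
    fun i j hi hj hij hij' => h3 _ _ hi hj (by omega) (by omega)⟩

theorem SeqLinked.reverse {lo hi : Option ℤ} {x : ℤ → V} {P : ℤ → RawPath V}
    (h : G.SeqLinked lo hi x P) :
    G.SeqLinked (hi.map fun b => -b) (lo.map fun a => -a) (fun m => x (-m))
      (fun m => (P (-m - 1)).reverse) := by
  obtain ⟨h1, h2⟩ := h
  simp only [SeqLinked, inGaps_neg_iff, interior_neg_iff, reachesLeft_reverse,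
    reachesRight_reverse, meetsOnlyTerminally_reverse, rightTipNode_reverse, leftTipNode_reverse]
  refine ⟨fun m hm => ?_, fun m hm => ?_⟩
  · obtain ⟨a, b, c, d⟩ := h1 _ hm
    rw [show -m - 1 + 1 = -m by ring] at b d
    rw [show -(m + 1) = -m - 1 by ring]
    exact ⟨b, a, d, c⟩
  · rw [show -(m - 1) - 1 = -m by ring]
    exact (h2 _ hm).symm

/-- All clauses are symmetric under reversal; in rank `ω⃗` the two monotonicity clauses trade
places. This lets statements about left ends be deduced from those about right ends. -/
theorem IsPath.reverse {p : RawPath V} {α : ℕ∞} (h : G.IsPath p α) : G.IsPath p.reverse α := by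
  induction p generalizing α with
  | edge => exact h
  | seq lo hi x P ih =>
    rw [IsPath] at h
    rw [RawPath.reverse, IsPath]
    obtain ⟨⟨m₀, h0⟩, hd, h⟩ := h
    refine ⟨⟨-m₀ - 1, inGaps_neg_iff.2 (by rwa [show -(-m₀ - 1) - 1 = m₀ by ring])⟩,
      hd.reverse, ?_⟩
    simp only [inRange_neg_iff, inGaps_neg_iff, interior_neg_iff]
    have hs : ∀ m : ℤ, -(m + 1) = -m - 1 := fun m => by ring
    have hs' : ∀ m : ℤ, -m - 1 + 1 = -m := fun m => by ring
    rcases h with ⟨h1, h2⟩ | ⟨h1, h2, h3, h4, h5, h6⟩ | ⟨h1, h2, h3, h4, ⟨c, h5, h6, h7⟩, h8⟩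
    · refine Or.inl ⟨h1, fun m hm => ?_⟩
      obtain ⟨a, b⟩ := h2 _ hm
      rw [hs'] at b
      rw [a, hs]
      exact ⟨rfl, b.symm⟩
    · refine Or.inr (Or.inl ⟨h1, h2, h3.reverse, fun m hm => h4 _ hm, fun m hm => h5 _ hm,
        fun m hm => ?_⟩)
      obtain ⟨β, hβ, hp⟩ := h6 _ hm
      exact ⟨β, hβ, ih _ hp⟩
    · refine Or.inr (Or.inr ⟨h1, by simpa using h2.symm, h3.reverse, fun m hm => h4 _ hm,
        ⟨-c, by simpa using h5, fun i j hi hj hc hij => h7 _ _ hj hi (by omega) (by omega),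
          fun i j hi hj hc hij => h6 _ _ hj hi (by omega) (by omega)⟩, fun m hm => ?_⟩)
      obtain ⟨β, hβ, hp⟩ := h8 _ hm
      rw [hs', max_comm] at hβ
      rw [hs]
      exact ⟨β, hβ, ih _ hp⟩

/-- The conditions on a path are inherited by its right half. The lemma shows that the
representative chosen by `rightRay` is a genuine ray, so that the tip condition of a cut applies to
it. -/
theorem IsPath.isRay_tail {lo : Option ℤ} {x : ℤ → V} {P : ℤ → RawPath V} {α : ℕ∞}
    (h : G.IsPath (.seq lo none x P) α) :
    G.IsRay (.seq (some (lo.getD 0)) none x P) α := by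
  refine ⟨⟨by simp, rfl⟩, ?_⟩
  cases lo with
  | some a => exact h
  | none =>
    rw [IsPath] at h ⊢
    obtain ⟨-, ⟨d1, d2, d3⟩, h⟩ := h
    have hr : ∀ m, InRange none none m := fun m => by simp [InRange]
    have hg : ∀ m, InGaps none none m := fun m => ⟨hr _, hr _⟩
    have hi : ∀ m, Interior none none m := fun m => ⟨hr _, hr _, hr _⟩
    have hl : G.SeqLinked none none x P → G.SeqLinked (some ((none : Option ℤ).getD 0)) none x P :=
      fun h => ⟨fun m _ => h.1 m (hg m), fun m _ => h.2 m (hi m)⟩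
    refine ⟨⟨0, by simp [InGaps, InRange]⟩, ⟨fun i j _ _ => d1 i j (hr _) (hr _),
      fun i j _ _ => d2 i j (hg _) (hg _), fun i j _ _ => d3 i j (hr _) (hg _)⟩, ?_⟩
    rcases h with ⟨h1, h2⟩ | ⟨h1, h2, h3, h4, h5, h6⟩ | ⟨h1, h2, h3, h4, ⟨c, h5, h6, h7⟩, h8⟩
    · exact Or.inl ⟨h1, fun m _ => h2 m (hg m)⟩
    · exact Or.inr (Or.inl ⟨h1, h2, hl h3, fun m _ => h4 m (hr m), fun m _ => h5 m (hi m),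
        fun m _ => h6 m (hg m)⟩)
    · refine Or.inr (Or.inr ⟨h1, Or.inr rfl, hl h3, fun m _ => h4 m (hr m),
        -- The turning point `c` may lie to the left of the truncation at `0`; then the turning
        -- point moves to `0` and the decreasing clause becomes vacuous.
        ⟨max c 0, by simp [InRange], fun i j _ _ hc => h6 i j (hr _) (hr _)
          (le_trans (le_max_left _ _) hc), fun i j hi _ hij hj => h7 i j (hr _) (hr _) hij ?_⟩,
        fun m _ => h8 m (hg m)⟩)
      have : 0 ≤ i := by simpa [InRange] using hi
      omega

/-! ### Darts and sums over disjoint pieces -/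

theorem IsPath.adj_of_mem_darts {p : RawPath V} {α : ℕ∞} (h : G.IsPath p α) :
    ∀ d ∈ p.darts, G.branches.Adj d.1 d.2 := by
  induction p generalizing α with
  | edge => exact h.elim
  | seq lo hi x P ih =>
    rw [IsPath] at h
    obtain ⟨-, -, h⟩ := h
    rintro d (⟨m, hm, he, rfl⟩ | ⟨m, hm, hd⟩) <;>
    rcases h with ⟨h1, h2⟩ | ⟨h1, h2, h3, h4, h5, h6⟩ | ⟨h1, h2, h3, h4, h5, h6⟩
    · exact (h2 m hm).2
    · obtain ⟨β, -, hp⟩ := h6 m hm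
      rw [he] at hp
      exact hp.elim
    · obtain ⟨β, -, hp⟩ := h6 m hm
      rw [he] at hp
      exact hp.elim
    · rw [(h2 m hm).1] at hd
      exact hd.elim
    · obtain ⟨β, -, hp⟩ := h6 m hm
      exact ih m hp d hd
    · obtain ⟨β, -, hp⟩ := h6 m hm
      exact ih m hp d hd

theorem IsLoop.adj_of_mem_darts {L : RawLoop V} {β : ℕ∞} (h : G.IsLoop L β) :
    ∀ d ∈ L.darts, G.branches.Adj d.1 d.2 := by
  obtain ⟨-, h⟩ := h
  rintro d (⟨m, hm, he, rfl⟩ | ⟨m, hm, hd⟩) <;> rcases h with ⟨h1, h2, h3⟩ | ⟨h1, h2, h3, h4, h5⟩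
  · exact (h3 m hm).2
  · obtain ⟨-, ⟨α, -, hp⟩, -⟩ := h5 m hm
    rw [he] at hp
    exact hp.elim
  · rw [(h3 m hm).1] at hd
    exact hd.elim
  · obtain ⟨-, ⟨α, -, hp⟩, -⟩ := h5 m hm
    exact hp.adj_of_mem_darts d hd

end TransfiniteData

/-- The flow of a dart out of a set `S` of nodes. -/
noncomputable def dartFlow {V : Type u} (S : Set V) (d : V × V) : ℝ :=
  S.indicator 1 d.1 - S.indicator 1 d.2

theorem dartFlow_eq_zero {V : Type u} {S : Set V} {d : V × V} (h : d.1 ∈ S ↔ d.2 ∈ S) :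
    dartFlow S d = 0 := by
  by_cases h1 : d.1 ∈ S
  · simp [dartFlow, h1, h.1 h1]
  · simp [dartFlow, h1, mt h.2 h1]

theorem indicator_one_congr {V : Type u} {S : Set V} {y z : V} (h : y ∈ S ↔ z ∈ S) :
    S.indicator (1 : V → ℝ) y = S.indicator 1 z := by
  by_cases h1 : y ∈ S
  · simp [h1, h.1 h1]
  · simp [h1, mt h.2 h1]

/-- By disjointness at most one summand is nonzero at a given point, and pieces outside `s`
contribute nothing because `f` vanishes there. This reduces a path with infinitely many constituents
to finitely many of them. -/
theorem indicator_biUnion_finset_eq_sum {ι β : Type*} (D : ι → Set β) (I : Set ι) (s : Finset ι)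
    (hs : ∀ m ∈ s, m ∈ I) (hD : ∀ i ∈ I, ∀ j ∈ I, i ≠ j → Disjoint (D i) (D j))
    (f : β → ℝ) (hout : ∀ m ∈ I, m ∉ s → ∀ d ∈ D m, f d = 0) (d : β) :
    (⋃ m ∈ I, D m).indicator f d = ∑ m ∈ s, (D m).indicator f d := by
  by_cases hd : ∃ m ∈ s, d ∈ D m
  · obtain ⟨m, hm, hdm⟩ := hd
    rw [Set.indicator_of_mem (Set.mem_biUnion (hs m hm) hdm), Finset.sum_eq_single m]
    · rw [Set.indicator_of_mem hdm]
    · intro j hj hjm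
      exact Set.indicator_of_notMem
        (fun hdj => Set.disjoint_left.1 (hD j (hs j hj) m (hs m hm) hjm) hdj hdm) f
    · exact fun h => (h hm).elim
  · push Not at hd
    rw [Finset.sum_eq_zero fun m hm => Set.indicator_of_notMem (hd m hm) f]
    refine Set.indicator_apply_eq_zero.2 fun h => ?_
    obtain ⟨m, hm, hdm⟩ := Set.mem_iUnion₂.1 h
    exact hout m hm (fun h => hd m h hdm) d hdm

theorem hasSum_indicator_biUnion {ι β : Type*} (D : ι → Set β) (I : Set ι) (s : Finset ι)
    (hs : ∀ m ∈ s, m ∈ I) (hD : ∀ i ∈ I, ∀ j ∈ I, i ≠ j → Disjoint (D i) (D j))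
    (f : β → ℝ) (hout : ∀ m ∈ I, m ∉ s → ∀ d ∈ D m, f d = 0) (c : ι → ℝ)
    (hc : ∀ m ∈ s, HasSum ((D m).indicator f) (c m)) :
    HasSum ((⋃ m ∈ I, D m).indicator f) (∑ m ∈ s, c m) := by
  rw [funext (indicator_biUnion_finset_eq_sum D I s hs hD f hout)]
  exact hasSum_sum hc

theorem sum_Ico_int_sub (f : ℤ → ℝ) {A B : ℤ} (h : A ≤ B) :
    ∑ m ∈ Finset.Ico A B, (f m - f (m + 1)) = f A - f B := by
  induction B, h using Int.leInduction with
  | base => simp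
  | succ n hn ih =>
    rw [← Finset.insert_Ico_right_eq_Ico_add_one hn, Finset.sum_insert (by simp), ih]
    ring

theorem sum_range_succ_mod (f : ℕ → ℝ) (k : ℕ) :
    ∑ m ∈ Finset.range k, f ((m + 1) % k) = ∑ m ∈ Finset.range k, f m := by
  cases k with
  | zero => simp
  | succ k =>
    rw [Finset.sum_range_succ, Finset.sum_range_succ', Nat.mod_self]
    congr 1
    refine Finset.sum_congr rfl fun m hm => ?_
    rw [Nat.mod_eq_of_lt (by simpa using hm)]

theorem hasSum_indicator_singleton {β : Type*} (d : β) (f : β → ℝ) :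
    HasSum (({d} : Set β).indicator f) (f d) := by
  have := hasSum_single (f := ({d} : Set β).indicator f) d
    (fun b hb => Set.indicator_of_notMem (by simpa using hb) f)
  simpa using this

namespace RawPath

variable {V : Type u}

/-- The darts of the part of a sequence between the nodes `m` and `m + 1`. -/
def gapDarts (x : ℤ → V) (P : ℤ → RawPath V) (m : ℤ) : Set (V × V) :=
  {d | P m = edge ∧ d = (x m, x (m + 1))} ∪ (P m).darts

theorem darts_seq (lo hi : Option ℤ) (x : ℤ → V) (P : ℤ → RawPath V) :
    (seq lo hi x P).darts = ⋃ m ∈ {m | InGaps lo hi m}, gapDarts x P m := by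
  ext d
  simp only [darts, gapDarts, Set.mem_union, Set.mem_ofPred_eq, Set.mem_iUnion, exists_prop]
  constructor
  · rintro (⟨m, h, h'⟩ | ⟨m, h, h'⟩)
    · exact ⟨m, h, Or.inl h'⟩
    · exact ⟨m, h, Or.inr h'⟩
  · rintro ⟨m, h, h' | h'⟩
    · exact Or.inl ⟨m, h, h'⟩
    · exact Or.inr ⟨m, h, h'⟩

theorem gapDarts_of_eq_edge {x : ℤ → V} {P : ℤ → RawPath V} {m : ℤ} (h : P m = edge) :
    gapDarts x P m = {(x m, x (m + 1))} := by
  ext d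
  simp [gapDarts, h, darts]

theorem gapDarts_of_ne_edge {x : ℤ → V} {P : ℤ → RawPath V} {m : ℤ} (h : P m ≠ edge) :
    gapDarts x P m = (P m).darts := by
  ext d
  simp [gapDarts, h]

end RawPath

theorem TransfiniteData.IsPath.ne_edge {V : Type u} {G : TransfiniteData V} {p : RawPath V}
    {α : ℕ∞} (h : G.IsPath p α) : p ≠ .edge := by
  rintro rfl
  exact h

theorem TransfiniteData.TotallyDisjoint.disjoint_darts {V : Type u} {G : TransfiniteData V}
    {p q : RawPath V} (h : G.TotallyDisjoint p.nodes q.nodes) : Disjoint p.darts q.darts :=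
  Set.disjoint_left.2 fun d hp hq => Set.disjoint_left.1 h.disjoint
    (p.mem_nodes_of_mem_darts d hp).1 (q.mem_nodes_of_mem_darts d hq).1

theorem TransfiniteData.ne_of_not_meets {V : Type u} {G : TransfiniteData V} {x y : V}
    (h : ¬ G.Meets x y) : x ≠ y := by
  rintro rfl
  exact h (G.meets_refl x)

/-- In rank `0` each gap is a single dart, recognized by its first node. In higher ranks the ends of
a dart are nodes of its constituent path, and distinct constituents share no node. -/
theorem TransfiniteData.IsPath.disjoint_gapDarts {V : Type u} {G : TransfiniteData V}
    {lo hi : Option ℤ} {x : ℤ → V} {P : ℤ → RawPath V} {α : ℕ∞}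
    (h : G.IsPath (.seq lo hi x P) α) {i j : ℤ} (hi' : InGaps lo hi i) (hj : InGaps lo hi j)
    (hij : i ≠ j) : Disjoint (RawPath.gapDarts x P i) (RawPath.gapDarts x P j) := by
  rw [IsPath] at h
  obtain ⟨-, ⟨d1, d2, -⟩, h⟩ := h
  have key : (∀ m, InGaps lo hi m → ∃ β, G.IsPath (P m) β) →
      Disjoint (RawPath.gapDarts x P i) (RawPath.gapDarts x P j) := fun hp => by
    rw [RawPath.gapDarts_of_ne_edge (hp i hi').choose_spec.ne_edge,
      RawPath.gapDarts_of_ne_edge (hp j hj).choose_spec.ne_edge]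
    exact (d2 i j hi' hj hij).disjoint_darts
  rcases h with ⟨h1, h2⟩ | ⟨h1, h2, h3, h4, h5, h6⟩ | ⟨h1, h2, h3, h4, h5, h6⟩
  · rw [RawPath.gapDarts_of_eq_edge (h2 i hi').1, RawPath.gapDarts_of_eq_edge (h2 j hj).1]
    simpa using fun h => (ne_of_not_meets (d1 i j hi'.1 hj.1 hij) h).elim
  · exact key fun m hm => (h6 m hm).imp fun _ h => h.2
  · exact key fun m hm => (h6 m hm).imp fun _ h => h.2

/-! ### Net flow of paths and loops through a cut -/

namespace TransfiniteGraph

variable {V : Type u} {ν : ℕ∞} {G : TransfiniteGraph V ν} {S : Set V}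

/-- A path that does not terminate on the right stays, from some index `B ≥ k` on, on the same side
of a cut as the node containing its right-hand tip. -/
theorem IsCutSide.exists_right_index (hS : G.IsCutSide S) {lo hi : Option ℤ} {x : ℤ → V}
    {P : ℤ → RawPath V} {α : ℕ∞} (hα : α + 1 ≤ ν) (h : G.IsPath (.seq lo hi x P) α) {t : V}
    (ht : (RawPath.seq lo hi x P).rightNode = some t ∨
      G.rightTipNode (.seq lo hi x P) = some t) {k : ℤ} (hk : InGaps lo hi k) :
    ∃ B, k < B ∧ InRange lo hi B ∧ (x B ∈ S ↔ t ∈ S) ∧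
      ∀ m, InGaps lo hi m → B ≤ m → ∀ d ∈ RawPath.gapDarts x P m, dartFlow S d = 0 := by
  cases hi with
  | some b =>
    obtain rfl : x b = t := by
      simpa [RawPath.rightNode, TransfiniteData.rightTipNode, RawPath.rightRay] using ht
    simp only [InGaps, InRange, Option.mem_def, Option.some.injEq, forall_eq'] at hk ⊢
    refine ⟨b, by omega, ⟨fun a ha => ?_, le_rfl⟩, Iff.rfl, fun m hm hb => by omega⟩
    have := hk.2.1 a ha
    omega
  | none =>
    obtain rfl : G.tipNode (.seq (some (lo.getD 0)) none x P) = t := by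
      simpa [RawPath.rightNode, TransfiniteData.rightTipNode, RawPath.rightRay] using ht
    obtain ⟨m₀, -, hm₀⟩ := hS.2 α _ hα h.isRay_tail
    have hr : ∀ m, m₀ ≤ m → InRange (some m₀) none m := fun m hm => by simpa [InRange] using hm
    -- From `m₀` on, all nodes lie on the side of the tip, so no later dart crosses the cut; `k + 1`
    -- only serves to place the index beyond the given gap.
    refine ⟨max m₀ (k + 1), by omega, ⟨fun a ha => ?_, by simp⟩,
      hm₀ _ (Or.inl ⟨_, hr _ (le_max_left _ _), rfl⟩), fun m hm hB d hd => ?_⟩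
    · have := hk.2.1 a ha
      omega
    · have hg : InGaps (some m₀) none m := ⟨hr _ (by omega), hr _ (by omega)⟩
      refine dartFlow_eq_zero ?_
      rcases hd with ⟨-, rfl⟩ | hd
      · exact (hm₀ _ (Or.inl ⟨_, hg.1, rfl⟩)).trans (hm₀ _ (Or.inl ⟨_, hg.2, rfl⟩)).symm
      · have := (P m).mem_nodes_of_mem_darts d hd
        exact (hm₀ _ (Or.inr ⟨_, hg, this.1⟩)).trans (hm₀ _ (Or.inr ⟨_, hg, this.2⟩)).symm

theorem dartFlow_swap (S : Set V) (d : V × V) : dartFlow S d.swap = - dartFlow S d := by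
  simp [dartFlow]

end TransfiniteGraph

theorem RawPath.mem_darts_reverse {V : Type u} (p : RawPath V) (d : V × V) :
    d ∈ p.reverse.darts ↔ d.swap ∈ p.darts := by
  induction p generalizing d with
  | edge => rfl
  | seq lo hi x P ih =>
    have hr : ∀ q : RawPath V, q.reverse = edge ↔ q = edge := fun q => by
      cases q <;> simp [reverse]
    simp only [reverse, darts, inGaps_neg_iff, Set.mem_union, Set.mem_ofPred_eq, hr, ih]
    refine or_congr ⟨?_, ?_⟩ ⟨?_, ?_⟩
    · rintro ⟨m, h, h', rfl⟩
      exact ⟨_, h, h', by rw [show -m - 1 + 1 = -m by ring, show -m - 1 = -(m + 1) by ring]; rfl⟩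
    · rintro ⟨m, h, h', hd⟩
      refine ⟨-m - 1, ?_, ?_, ?_⟩
      · rwa [show -(-m - 1) - 1 = m by ring]
      · rwa [show -(-m - 1) - 1 = m by ring]
      · rw [← Prod.swap_swap d, hd, show -(-m - 1) = m + 1 by ring,
          show -(-m - 1 + 1) = m by ring]
        rfl
    · rintro ⟨m, h, h'⟩
      exact ⟨_, h, h'⟩
    · rintro ⟨m, h, h'⟩
      refine ⟨-m - 1, ?_, ?_⟩ <;> rwa [show -(-m - 1) - 1 = m by ring]

theorem RawPath.mem_gapDarts_reverse {V : Type u} {x : ℤ → V} {P : ℤ → RawPath V} {m : ℤ}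
    {d : V × V} (hd : d ∈ gapDarts x P m) :
    d.swap ∈ gapDarts (fun m => x (-m)) (fun m => (P (-m - 1)).reverse) (-m - 1) := by
  rcases hd with ⟨h, rfl⟩ | hd
  · refine Or.inl ⟨?_, ?_⟩
    · simp only [show -(-m - 1) - 1 = m by ring, h]
      rfl
    · simp only [show -(-m - 1) = m + 1 by ring, show -(-m - 1 + 1) = m by ring]
      rfl
  · refine Or.inr ?_
    simpa only [show -(-m - 1) - 1 = m by ring, mem_darts_reverse, Prod.swap_swap] using hd

namespace TransfiniteGraph

variable {V : Type u} {ν : ℕ∞} {G : TransfiniteGraph V ν} {S : Set V}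

/-- A path that does not terminate on the left stays, up to some index `A ≤ k`, on the same side
of a cut as the node containing its left-hand tip. -/
theorem IsCutSide.exists_left_index (hS : G.IsCutSide S) {lo hi : Option ℤ} {x : ℤ → V}
    {P : ℤ → RawPath V} {α : ℕ∞} (hα : α + 1 ≤ ν) (h : G.IsPath (.seq lo hi x P) α) {t : V}
    (ht : (RawPath.seq lo hi x P).leftNode = some t ∨
      G.leftTipNode (.seq lo hi x P) = some t) {k : ℤ} (hk : InGaps lo hi k) :
    ∃ A, A ≤ k ∧ InRange lo hi A ∧ (x A ∈ S ↔ t ∈ S) ∧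
      ∀ m, InGaps lo hi m → m < A → ∀ d ∈ RawPath.gapDarts x P m, dartFlow S d = 0 := by
  have hs : ∀ m : ℤ, -(-m - 1) - 1 = m := fun m => by ring
  -- The gap `k` becomes `-k - 1` in the reversed path, so `-k - 1 < B` reads `-B ≤ k`. Reversal
  -- only changes the sign of a flow, so zero flows stay zero.
  obtain ⟨B, h1, h2, h3, h4⟩ := hS.exists_right_index hα h.reverse ht (k := -k - 1)
    (inGaps_neg_iff.2 (by rwa [hs]))
  refine ⟨-B, by omega, inRange_neg_iff.1 h2, h3, fun m hm hA d hd => ?_⟩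
  have := h4 (-m - 1) (inGaps_neg_iff.2 (by rwa [hs])) (by omega) _
    (RawPath.mem_gapDarts_reverse hd)
  rwa [dartFlow_swap, neg_eq_zero] at this

/-- The net number of times that a path leaves one side of a cut is determined by its ends. -/
theorem IsCutSide.hasSum_darts (hS : G.IsCutSide S) {p : RawPath V} {α : ℕ∞} (hα : α + 1 ≤ ν)
    (h : G.IsPath p α) {s t : V} (hs : p.leftNode = some s ∨ G.leftTipNode p = some s)
    (ht : p.rightNode = some t ∨ G.rightTipNode p = some t) :
    HasSum (p.darts.indicator (dartFlow S)) (S.indicator 1 s - S.indicator 1 t) := by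
  induction p generalizing α s t with
  | edge => exact h.elim
  | seq lo hi x P ih =>
    have h' := h
    rw [TransfiniteData.IsPath] at h'
    obtain ⟨⟨k, hk⟩, -, h'⟩ := h'
    -- Both indices are taken around the same gap `k`, so `A ≤ k < B`; all crossings occur in the
    -- gaps from `A` to `B - 1`.
    obtain ⟨A, hAk, hA, hAs, hA0⟩ := hS.exists_left_index hα h hs hk
    obtain ⟨B, hkB, hB, hBt, hB0⟩ := hS.exists_right_index hα h ht hk
    have hlinked : ∀ m, InGaps lo hi m → G.SeqLinked lo hi x P →
        (∃ β, β + 1 ≤ ν ∧ G.IsPath (P m) β) →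
        HasSum ((RawPath.gapDarts x P m).indicator (dartFlow S))
          (S.indicator 1 (x m) - S.indicator 1 (x (m + 1))) := by
      rintro m hm hl ⟨β, hβ, hp⟩
      -- The ends of the constituent need only be embraced by `x m` and `x (m + 1)`, but embracing
      -- never crosses the cut, so the indicators agree.
      obtain ⟨⟨s', hs', hms⟩, ⟨t', ht', hmt⟩, -⟩ := hl.1 m hm
      rw [RawPath.gapDarts_of_ne_edge hp.ne_edge, indicator_one_congr (hS.1 _ _ hms),
        indicator_one_congr (hS.1 _ _ hmt)]
      exact ih m hβ hp hs' ht'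
    have hgap : ∀ m, InGaps lo hi m → HasSum ((RawPath.gapDarts x P m).indicator (dartFlow S))
        (S.indicator 1 (x m) - S.indicator 1 (x (m + 1))) := by
      intro m hm
      rcases h' with ⟨h1, h2⟩ | ⟨h1, h2, h3, h4, h5, h6⟩ | ⟨h1, h2, h3, h4, h5, h6⟩
      · rw [RawPath.gapDarts_of_eq_edge (h2 m hm).1]
        exact hasSum_indicator_singleton _ (dartFlow S)
      · obtain ⟨β, hβ, hp⟩ := h6 m hm
        exact hlinked m hm h3 ⟨β, hβ.trans (le_self_add.trans hα), hp⟩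
      · obtain ⟨β, hβ, hp⟩ := h6 m hm
        -- In rank `ω⃗` the hypothesis reads `⊤ + 1 ≤ ν`, which forces `ν = ⊤` and leaves no bound
        -- on `β` to check.
        subst h1
        exact hlinked m hm h3 ⟨β, le_top.trans hα, hp⟩
    rw [RawPath.darts_seq, ← indicator_one_congr hAs, ← indicator_one_congr hBt,
      ← sum_Ico_int_sub (fun m => S.indicator (1 : V → ℝ) (x m)) (hAk.trans hkB.le)]
    have hmem : ∀ m ∈ Finset.Ico A B, InGaps lo hi m := fun m hm => by
      rw [Finset.mem_Ico] at hm
      exact ⟨InRange.of_between hA hB hm.1 hm.2.le, InRange.of_between hA hB (by omega) (by omega)⟩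
    refine hasSum_indicator_biUnion _ _ _ hmem (fun i hi' j hj => h.disjoint_gapDarts hi' hj) _
      (fun m hm hout d hd => ?_) _ (fun m hm => hgap m (hmem m hm))
    rw [Finset.mem_Ico, not_and_or, not_le, not_lt] at hout
    rcases hout with hout | hout
    · exact hA0 m hm hout d hd
    · exact hB0 m hm hout d hd

/-- A loop leaves one side of a cut as often as it enters it. -/
theorem IsCutSide.hasSum_loop_darts (hS : G.IsCutSide S) {L : RawLoop V} {β : ℕ∞} (hβ : β ≤ ν)
    (h : G.IsLoop L β) : HasSum (L.darts.indicator (dartFlow S)) 0 := by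
  obtain ⟨hx, h⟩ := h
  -- Zero is written as a cyclic telescoping sum with one term for each constituent.
  have h0 : ∑ m ∈ Finset.range L.len,
      (S.indicator (1 : V → ℝ) (L.x m) - S.indicator 1 (L.next m)) = 0 := by
    rw [Finset.sum_sub_distrib, sub_eq_zero]
    exact (sum_range_succ_mod (fun m => S.indicator (1 : V → ℝ) (L.x m)) L.len).symm
  rw [← h0]
  rcases h with ⟨-, -, h⟩ | ⟨-, -, hd, -, h⟩
  · have hD : L.darts = ⋃ m ∈ {m | m < L.len}, {(L.x m, L.next m)} := by
      ext d
      simp only [RawLoop.darts, Set.mem_union, Set.mem_ofPred_eq, Set.mem_iUnion, exists_prop,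
        Set.mem_singleton_iff]
      constructor
      · rintro (⟨m, hm, -, rfl⟩ | ⟨m, hm, hd⟩)
        · exact ⟨m, hm, rfl⟩
        · rw [(h m hm).1] at hd
          exact hd.elim
      · rintro ⟨m, hm, rfl⟩
        exact Or.inl ⟨m, hm, (h m hm).1, rfl⟩
    rw [hD]
    refine hasSum_indicator_biUnion _ _ _ (fun m => Finset.mem_range.1) (fun i hi j hj hij => ?_) _
      (fun m hm hm' => (hm' (Finset.mem_range.2 hm)).elim) _
      (fun m hm => hasSum_indicator_singleton _ (dartFlow S))
    simpa using fun h => (TransfiniteData.ne_of_not_meets (hx i hi j hj hij) h).elim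
  · have hD : L.darts = ⋃ m ∈ {m | m < L.len}, (L.P m).darts := by
      ext d
      simp only [RawLoop.darts, Set.mem_union, Set.mem_ofPred_eq, Set.mem_iUnion, exists_prop]
      refine or_iff_right ?_
      rintro ⟨m, hm, he, -⟩
      obtain ⟨-, ⟨α, -, hp⟩, -⟩ := h m hm
      exact hp.ne_edge he
    rw [hD]
    refine hasSum_indicator_biUnion _ _ _ (fun m => Finset.mem_range.1)
      (fun i hi j hj hij => (hd i hi j hj hij).disjoint_darts) _
      (fun m hm hm' => (hm' (Finset.mem_range.2 hm)).elim) _ (fun m hm => ?_)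
    obtain ⟨-, ⟨α, hα, hp⟩, ⟨s, hs, hms⟩, ⟨t, ht, hmt⟩, -⟩ := h m (by simpa using hm)
    rw [indicator_one_congr (hS.1 _ _ hms), indicator_one_congr (hS.1 _ _ hmt)]
    exact hS.hasSum_darts (hα.trans hβ) hp hs ht

theorem embraces_iff_eq_of_rank_eq_zero {x y : V} (hx : G.rank x = 0) :
    G.Embraces x y ↔ y = x := by
  refine ⟨fun h => ?_, fun h => h ▸ Relation.ReflTransGen.refl⟩
  rcases Relation.ReflTransGen.cases_head h with h | ⟨z, hz, -⟩
  · exact h.symm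
  · have := G.rank_exc x z hz
    simp [hx] at this

theorem IsMaximal.eq_of_embraces {x y : V} (hx : G.IsMaximal x) (h : G.Embraces y x) : y = x := by
  rcases Relation.ReflTransGen.cases_tail h with h | ⟨z, -, hz⟩
  · exact h.symm
  · exact (hx z hz).elim

/-- A maximal 0-node meets only itself, and it contains no tip since tips lie in nodes of positive
rank. By the disjointness conditions a ray has `x` at no more than one index of its sequence and
inside no more than one constituent, so some tail avoids `x`. -/
theorem isCutSide_singleton {x : V} (h0 : G.rank x = 0) (hx : G.IsMaximal x) :
    G.IsCutSide {x} := by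
  refine ⟨fun y z hyz => ?_, fun α p hα hp => ?_⟩
  · simp only [Set.mem_singleton_iff]
    constructor
    · rintro rfl
      exact (embraces_iff_eq_of_rank_eq_zero h0).1 hyz
    · rintro rfl
      exact hx.eq_of_embraces hyz
  · have htip : G.tipNode p ≠ x := by
      rintro rfl
      rw [G.rank_tipNode α p hα hp] at h0
      simp at h0
    simp only [Set.mem_singleton_iff, htip, iff_false]
    obtain ⟨h1, h2⟩ := hp
    cases p with
    | edge => exact h2.elim
    | seq lo hi y P =>
      obtain ⟨hlo, rfl⟩ := h1
      rw [TransfiniteData.IsPath] at h2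
      obtain ⟨-, ⟨d1, d2, -⟩, -⟩ := h2
      obtain ⟨a, rfl⟩ := Option.ne_none_iff_exists'.1 hlo
      have hr : ∀ m, InRange (some a) none m ↔ a ≤ m := fun m => by simp [InRange]
      have hg : ∀ m, InGaps (some a) none m ↔ a ≤ m := fun m => by
        rw [InGaps, hr, hr]
        omega
      have e1 : ∃ M, ∀ m, a ≤ m → M ≤ m → y m ≠ x := by
        by_cases h : ∃ i, a ≤ i ∧ y i = x
        · obtain ⟨i, hi, rfl⟩ := h
          exact ⟨i + 1, fun m hm hm' => TransfiniteData.ne_of_not_meets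
            (d1 m i ((hr _).2 hm) ((hr _).2 hi) (by omega))⟩
        · push Not at h
          exact ⟨0, fun m hm _ => h m hm⟩
      have e2 : ∃ M, ∀ m, a ≤ m → M ≤ m → x ∉ (P m).nodes := by
        by_cases h : ∃ i, a ≤ i ∧ x ∈ (P i).nodes
        · obtain ⟨i, hi, hxi⟩ := h
          exact ⟨i + 1, fun m hm hm' hxm => Set.disjoint_left.1
            (d2 m i ((hg _).2 hm) ((hg _).2 hi) (by omega)).disjoint hxm hxi⟩
        · push Not at h
          exact ⟨0, fun m hm _ => h m hm⟩
      obtain ⟨M₁, h1⟩ := e1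
      obtain ⟨M₂, h2⟩ := e2
      refine ⟨max a (max M₁ M₂), (hr _).2 (le_max_left _ _), ?_⟩
      rintro z (⟨m, hm, rfl⟩ | ⟨m, hm, hz⟩)
      · have := hm.1 _ rfl
        exact h1 m (by omega) (by omega)
      · have := hm.1.1 _ rfl
        rintro rfl
        exact h2 m (by omega) (by omega) hz

end TransfiniteGraph

/-! ### From darts to branches: incidence against loop currents -/

namespace ResistiveNetwork

variable {V : Type u} {ν : ℕ∞} {G : TransfiniteGraph V ν} (N : ResistiveNetwork G)

theorem tail_ne_head (b : G.Branch) : N.tail b ≠ N.head b := by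
  have h := b.2
  rw [N.orient b, SimpleGraph.mem_edgeSet] at h
  exact h.ne

/-- A branch traversed along (`true`) or against (`false`) its orientation. -/
def dart (k : G.Branch × Bool) : V × V :=
  if k.2 then (N.tail k.1, N.head k.1) else (N.head k.1, N.tail k.1)

/-- The unordered pair recovers the branch, and the direction is then determined because tail and
head differ. -/
theorem dart_injective : Function.Injective N.dart := by
  rintro ⟨b, k⟩ ⟨b', k'⟩ h
  have hs : ∀ (b : G.Branch) (k : Bool), s((N.dart (b, k)).1, (N.dart (b, k)).2) = (b : Sym2 V) := by
    intro b k
    cases k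
    · exact Sym2.eq_swap.trans (N.orient b).symm
    · exact (N.orient b).symm
  obtain rfl : b = b' := Subtype.ext (by rw [← hs b k, ← hs b' k', h])
  have := N.tail_ne_head b
  cases k <;> cases k' <;> simp_all [dart]

theorem mem_range_dart {d : V × V} (h : G.branches.Adj d.1 d.2) : d ∈ Set.range N.dart := by
  let b : G.Branch := ⟨s(d.1, d.2), h⟩
  have hb : s(d.1, d.2) = s(N.tail b, N.head b) := N.orient b
  rcases Sym2.eq_iff.1 hb with ⟨h1, h2⟩ | ⟨h1, h2⟩
  · exact ⟨(b, true), Prod.ext h1.symm h2.symm⟩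
  · exact ⟨(b, false), Prod.ext h1.symm h2.symm⟩

open Classical in
/-- The unit current around a loop has no net flow through a cut. -/
theorem hasSum_incidence_mul_loopCurrent {S : Set V} (hS : G.IsCutSide S) {L : RawLoop V}
    (hL : N.IsLoop L) : HasSum (fun b => N.incidence S b * N.loopCurrent L b) 0 := by
  obtain ⟨β, hβ, hL⟩ := hL
  have h := hS.hasSum_loop_darts hβ hL
  -- Darts of a loop come from branches, so the sum over pairs of nodes is one over directed
  -- branches; summing the two directions of each branch gives incidence times loop current.
  rw [← N.dart_injective.hasSum_iff fun d hd => Set.indicator_of_notMem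
    (fun hdL => hd (N.mem_range_dart (hL.adj_of_mem_darts d hdL))) _] at h
  have h' := h.prod_fiberwise fun b => hasSum_fintype _
  convert h' using 2 with b
  simp only [Fintype.sum_bool, Function.comp_apply, dart, incidence, loopCurrent, dartFlow,
    Set.indicator_apply, Pi.one_apply]
  simp only [if_true, Bool.false_eq_true, if_false]
  split_ifs <;> norm_num

end ResistiveNetwork

/-! ### Finite-power currents as a Hilbert space -/

theorem HasSum.of_forall_eq {ι : Type*} {f g : ι → ℝ} {a : ℝ} (h : HasSum g a)
    (hfg : ∀ b, f b = g b) : HasSum f a :=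
  funext hfg ▸ h

namespace ResistiveNetwork

variable {V : Type u} {ν : ℕ∞} {G : TransfiniteGraph V ν} (N : ResistiveNetwork G)

theorem sqrt_r_ne_zero (b : G.Branch) : √(N.r b) ≠ 0 := (Real.sqrt_pos.2 (N.r_pos b)).ne'

theorem sqrt_r_mul_self (b : G.Branch) : √(N.r b) * √(N.r b) = N.r b :=
  Real.mul_self_sqrt (N.r_pos b).le

/-- The current vector `f b / √(r b)` of finite power that corresponds to a vector `f` in `ℓ²`. -/
noncomputable def ofLp : lp (fun _ : G.Branch => ℝ) 2 →ₗ[ℝ] (G.Branch → ℝ) where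
  toFun f b := f b / √(N.r b)
  map_add' f g := by
    ext b
    simp [add_div]
  map_smul' c f := by
    ext b
    simp [mul_div_assoc]

theorem ofLp_apply (f : lp (fun _ : G.Branch => ℝ) 2) (b : G.Branch) :
    N.ofLp f b = f b / √(N.r b) := rfl

theorem exists_lp_of_summable_sq {ι : Type*} {f : ι → ℝ} (hf : Summable fun b => f b ^ 2) :
    ∃ g : lp (fun _ : ι => ℝ) 2, ∀ b, g b = f b :=
  ⟨⟨f, memℓp_gen (by simpa using hf)⟩, fun _ => rfl⟩

theorem hasSum_mul_lp {ι : Type*} (f g : lp (fun _ : ι => ℝ) 2) :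
    HasSum (fun b => f b * g b) (inner ℝ f g) := by
  have h := lp.hasSum_inner (𝕜 := ℝ) f g
  simp only [RCLike.inner_apply, conj_trivial, mul_comm] at h
  exact h

/-- The two factors `1 / √r` cancel the weight `r`: `ofLp` carries the `ℓ²` inner product to the
power form. -/
theorem hasSum_r_mul_ofLp_mul_ofLp (f g : lp (fun _ : G.Branch => ℝ) 2) :
    HasSum (fun b => N.r b * (N.ofLp f b * N.ofLp g b)) (inner ℝ f g) := by
  refine HasSum.of_forall_eq (hasSum_mul_lp f g) fun b => ?_
  rw [ofLp_apply, ofLp_apply, div_mul_div_comm, N.sqrt_r_mul_self,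
    mul_div_cancel₀ _ (N.r_pos b).ne']

theorem hasSum_r_mul_ofLp_sq (f : lp (fun _ : G.Branch => ℝ) 2) :
    HasSum (fun b => N.r b * N.ofLp f b ^ 2) (‖f‖ ^ 2) := by
  simpa only [pow_two, real_inner_self_eq_norm_mul_norm] using N.hasSum_r_mul_ofLp_mul_ofLp f f

theorem exists_ofLp_eq {s : G.Branch → ℝ} (hs : Summable fun b => N.r b * s b ^ 2) :
    ∃ f, N.ofLp f = s := by
  obtain ⟨f, hf⟩ := exists_lp_of_summable_sq (f := fun b => √(N.r b) * s b)
    (by simpa only [mul_pow, Real.sq_sqrt (N.r_pos _).le] using hs)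
  exact ⟨f, funext fun b => by rw [ofLp_apply, hf, mul_div_cancel_left₀ _ (N.sqrt_r_ne_zero b)]⟩

/-- A functional on the current vectors, given by coefficients `w` such that `∑ w_b² / r_b` is
finite, is represented by a vector in `ℓ²`. -/
theorem exists_hasSum_mul_ofLp {w : G.Branch → ℝ} (hw : Summable fun b => w b ^ 2 / N.r b) :
    ∃ g : lp (fun _ : G.Branch => ℝ) 2, ∀ f, HasSum (fun b => w b * N.ofLp f b) (inner ℝ g f) := by
  obtain ⟨g, hg⟩ := exists_lp_of_summable_sq (f := fun b => w b / √(N.r b))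
    (by simpa only [div_pow, Real.sq_sqrt (N.r_pos _).le] using hw)
  refine ⟨g, fun f => ?_⟩
  refine HasSum.of_forall_eq (hasSum_mul_lp g f) fun b => ?_
  rw [hg, ofLp_apply]
  ring

/-- The closed subspace of `ℓ²` that corresponds to the solution space. -/
noncomputable def lpSolutionSpace : Submodule ℝ (lp (fun _ : G.Branch => ℝ) 2) :=
  (N.loopSpan.comap N.ofLp).topologicalClosure

/-- The values are `-1`, `0` and `1`. Hence perceptibility says exactly that the unit loop current
has finite power; likewise, restraint says that the incidence defines a bounded functional. -/
theorem loopCurrent_sq (L : RawLoop V) (b : G.Branch) :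
    N.loopCurrent L b ^ 2 = |N.loopCurrent L b| := by
  unfold loopCurrent
  split_ifs <;> norm_num

theorem incidence_sq (S : Set V) (b : G.Branch) : N.incidence S b ^ 2 = |N.incidence S b| := by
  unfold incidence
  split_ifs <;> norm_num

theorem Perceptible.summable {L : RawLoop V} (hL : N.Perceptible L) :
    Summable fun b => N.r b * N.loopCurrent L b ^ 2 := by
  unfold Perceptible at hL
  simpa only [loopCurrent_sq, mul_comm] using hL

theorem Restraining.summable {S : Set V} (hS : N.Restraining S) :
    Summable fun b => N.incidence S b ^ 2 / N.r b := by
  unfold Restraining at hS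
  simpa only [incidence_sq] using hS

/-- Perceptible loops carry unit currents of finite power, so nothing is lost when the span is
pulled back to `ℓ²`. -/
theorem loopSpan_le_range : N.loopSpan ≤ LinearMap.range N.ofLp := by
  refine Submodule.span_le.2 ?_
  rintro _ ⟨L, -, hL, rfl⟩
  exact N.exists_ofLp_eq (hL.summable N)

theorem mem_solutionSpace_of_mem_loopSpan {t : G.Branch → ℝ} (ht : t ∈ N.loopSpan) :
    t ∈ N.solutionSpace := by
  obtain ⟨f, rfl⟩ := N.loopSpan_le_range ht
  exact ⟨(N.hasSum_r_mul_ofLp_sq f).summable, fun ε hε => ⟨_, ht, by simpa using hε⟩⟩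

/-- The power of a difference of currents is the squared `ℓ²` distance, so the two notions of
closure agree after exchanging `ε` with `ε ^ 2` or `√ε`. -/
theorem ofLp_mem_solutionSpace {f : lp (fun _ : G.Branch => ℝ) 2} :
    N.ofLp f ∈ N.solutionSpace ↔ f ∈ N.lpSolutionSpace := by
  have hd : ∀ g, ∑' b, N.r b * (N.ofLp f b - N.ofLp g b) ^ 2 = dist f g ^ 2 := fun g => by
    rw [dist_eq_norm, ← (N.hasSum_r_mul_ofLp_sq (f - g)).tsum_eq, map_sub]
    rfl
  rw [lpSolutionSpace, ← SetLike.mem_coe, Submodule.topologicalClosure_coe, Metric.mem_closure_iff]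
  constructor
  · rintro ⟨-, h⟩ ε hε
    obtain ⟨t, ht, hlt⟩ := h (ε ^ 2) (by positivity)
    obtain ⟨g, rfl⟩ := N.loopSpan_le_range ht
    rw [hd] at hlt
    exact ⟨g, ht, lt_of_pow_lt_pow_left₀ 2 hε.le hlt⟩
  · refine fun h => ⟨(N.hasSum_r_mul_ofLp_sq f).summable, fun ε hε => ?_⟩
    obtain ⟨g, hg, hlt⟩ := h (√ε) (Real.sqrt_pos.2 hε)
    exact ⟨N.ofLp g, hg, by rw [hd]; exact (Real.lt_sqrt dist_nonneg).1 hlt⟩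

theorem exists_of_mem_solutionSpace {s : G.Branch → ℝ} (hs : s ∈ N.solutionSpace) :
    ∃ f ∈ N.lpSolutionSpace, N.ofLp f = s := by
  obtain ⟨f, rfl⟩ := N.exists_ofLp_eq hs.1
  exact ⟨f, N.ofLp_mem_solutionSpace.1 hs, rfl⟩

theorem sub_mem_solutionSpace {s t : G.Branch → ℝ} (hs : s ∈ N.solutionSpace)
    (ht : t ∈ N.solutionSpace) : s - t ∈ N.solutionSpace := by
  obtain ⟨f, hf, rfl⟩ := N.exists_of_mem_solutionSpace hs
  obtain ⟨g, hg, rfl⟩ := N.exists_of_mem_solutionSpace ht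
  rw [← map_sub, ofLp_mem_solutionSpace]
  exact sub_mem hf hg

theorem summable_r_mul_mul {s t : G.Branch → ℝ} (hs : s ∈ N.solutionSpace)
    (ht : t ∈ N.solutionSpace) : Summable fun b => N.r b * (s b * t b) := by
  obtain ⟨f, -, rfl⟩ := N.exists_of_mem_solutionSpace hs
  obtain ⟨g, -, rfl⟩ := N.exists_of_mem_solutionSpace ht
  exact (N.hasSum_r_mul_ofLp_mul_ofLp f g).summable

theorem summable_mul_of_mem {w s : G.Branch → ℝ} (hw : Summable fun b => w b ^ 2 / N.r b)
    (hs : s ∈ N.solutionSpace) : Summable fun b => w b * s b := by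
  obtain ⟨f, -, rfl⟩ := N.exists_of_mem_solutionSpace hs
  obtain ⟨g, hg⟩ := N.exists_hasSum_mul_ofLp hw
  exact (hg f).summable

/-! ### Tellegen's equation and Kirchhoff's laws in a standard network -/

/-- Tellegen's equation has a solution in the solution space. -/
theorem exists_tellegen (hN : N.FiniteIsolatedPower) :
    ∃ i ∈ N.solutionSpace, ∀ s ∈ N.solutionSpace,
      ∑' b, N.r b * (i b * s b) = ∑' b, N.e b * s b := by
  obtain ⟨g, hg⟩ := N.exists_hasSum_mul_ofLp hN
  have : CompleteSpace N.lpSolutionSpace :=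
    (Submodule.isClosed_topologicalClosure _).completeSpace_coe
  -- The vector `g` represents the source functional, and Tellegen's equation says that `g` minus
  -- the current is orthogonal to the subspace.
  refine ⟨N.ofLp (N.lpSolutionSpace.starProjection g), N.ofLp_mem_solutionSpace.2
    (Submodule.starProjection_apply_mem _ _), fun s hs => ?_⟩
  obtain ⟨f, hf, rfl⟩ := N.exists_of_mem_solutionSpace hs
  rw [(hg f).tsum_eq, (N.hasSum_r_mul_ofLp_mul_ofLp _ f).tsum_eq, eq_comm, ← sub_eq_zero,
    ← inner_sub_left]
  exact Submodule.starProjection_inner_eq_zero g f hf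

/-- Tellegen's equation has at most one solution in the solution space; it is enough to test it on
the difference of two solutions. -/
theorem eq_of_tellegen {i j : G.Branch → ℝ} (hi : i ∈ N.solutionSpace) (hj : j ∈ N.solutionSpace)
    (h : ∑' b, N.r b * (i b * (i - j) b) = ∑' b, N.r b * (j b * (i - j) b)) : i = j := by
  obtain ⟨f, -, rfl⟩ := N.exists_of_mem_solutionSpace hi
  obtain ⟨g, -, rfl⟩ := N.exists_of_mem_solutionSpace hj
  -- The hypothesis becomes the vanishing of the inner product of `f - g` with itself.
  rw [← map_sub, (N.hasSum_r_mul_ofLp_mul_ofLp _ _).tsum_eq,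
    (N.hasSum_r_mul_ofLp_mul_ofLp _ _).tsum_eq, ← sub_eq_zero, ← inner_sub_left,
    inner_self_eq_zero (𝕜 := ℝ), sub_eq_zero] at h
  rw [h]

/-- Kirchhoff's voltage law around a perceptible loop. -/
theorem hasSum_loopCurrent_mul_voltage (hN : N.FiniteIsolatedPower) {i : G.Branch → ℝ}
    (hi : i ∈ N.solutionSpace) {L : RawLoop V} (hL : N.IsLoop L) (hp : N.Perceptible L)
    (h : ∑' b, N.r b * (i b * N.loopCurrent L b) = ∑' b, N.e b * N.loopCurrent L b) :
    HasSum (fun b => N.loopCurrent L b * (N.r b * i b - N.e b)) 0 := by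
  have hs : N.loopCurrent L ∈ N.solutionSpace :=
    N.mem_solutionSpace_of_mem_loopSpan (Submodule.subset_span ⟨L, hL, hp, rfl⟩)
  have := (N.summable_r_mul_mul hi hs).hasSum.sub (N.summable_mul_of_mem hN hs).hasSum
  rw [h, sub_self] at this
  refine HasSum.of_forall_eq this fun b => ?_
  ring

/-- Kirchhoff's current law at a restraining cut. -/
theorem hasSum_incidence_mul {S : Set V} (hS : G.IsCutSide S) (hr : N.Restraining S)
    {i : G.Branch → ℝ} (hi : i ∈ N.solutionSpace) :
    HasSum (fun b => N.incidence S b * i b) 0 := by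
  obtain ⟨f, hf, rfl⟩ := N.exists_of_mem_solutionSpace hi
  obtain ⟨g, hg⟩ := N.exists_hasSum_mul_ofLp (hr.summable N)
  have hspan : ∀ t ∈ N.loopSpan, HasSum (fun b => N.incidence S b * t b) 0 := by
    intro t ht
    induction ht using Submodule.span_induction with
    | mem t ht =>
      obtain ⟨L, hL, -, rfl⟩ := ht
      exact N.hasSum_incidence_mul_loopCurrent hS hL
    | zero => simp
    | add s t _ _ hs ht => simpa [mul_add] using hs.add ht
    | smul c t _ ht => simpa [mul_left_comm] using ht.mul_left c
  -- An orthogonal complement is closed, so orthogonality to `g` passes from the loop span to its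
  -- closure.
  have hle : N.lpSolutionSpace ≤ (Submodule.span ℝ {g})ᗮ := by
    refine Submodule.topologicalClosure_minimal _ (fun f hf => ?_)
      (Submodule.isClosed_orthogonal _)
    rw [Submodule.mem_orthogonal_singleton_iff_inner_right]
    exact (hg f).unique (hspan _ hf)
  have h0 := Submodule.mem_orthogonal_singleton_iff_inner_right.1 (hle hf)
  rw [← h0]
  exact hg f

end ResistiveNetwork

/-! ### Transfer to the ultraproduct -/

namespace Nonstandard

variable {V : ℕ → Type u} {ν : ℕ∞} {F : Ultrafilter ℕ} {G : ∀ n, TransfiniteGraph (V n) ν}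
  (N : ∀ n, ResistiveNetwork (G n))

/-- Internal test vectors are exactly the classes of sequences. The set of indices at which
Tellegen's equation holds may depend on the test sequence. -/
theorem isOperatingPoint_mk_iff {i : ∀ n, (G n).Branch → ℝ} {v : BranchVector F G} :
    IsOperatingPoint N (Quotient.mk _ i) v ↔
      (∀ᶠ n in (F : Filter ℕ), i n ∈ (N n).solutionSpace) ∧
      v = Quotient.mk _ (fun n b => (N n).r b * i n b - (N n).e b) ∧
      ∀ s : ∀ n, (G n).Branch → ℝ, (∀ᶠ n in (F : Filter ℕ), s n ∈ (N n).solutionSpace) →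
        ∀ᶠ n in (F : Filter ℕ),
          ∑' b, (N n).r b * (i n b * s n b) = ∑' b, (N n).e b * s n b := by
  refine and_congr Iff.rfl (and_congr Iff.rfl ⟨fun h s hs => ?_, fun h s hs => ?_⟩)
  · exact Filter.Germ.coe_eq.1 (h (Quotient.mk _ s) hs)
  · induction s using Quotient.inductionOn
    exact Filter.Germ.coe_eq.2 (h _ hs)

theorem exists_isOperatingPoint (hN : ∀ᶠ n in (F : Filter ℕ), (N n).FiniteIsolatedPower) :
    ∃ i v : BranchVector F G, IsOperatingPoint N i v := by
  classical
  choose i hi using fun n (h : (N n).FiniteIsolatedPower) => (N n).exists_tellegen h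
  let j : ∀ n, (G n).Branch → ℝ := fun n =>
    if h : (N n).FiniteIsolatedPower then i n h else 0
  have hj : ∀ n (h : (N n).FiniteIsolatedPower), j n = i n h := fun n h => dif_pos h
  refine ⟨Quotient.mk _ j, _, (isOperatingPoint_mk_iff N).2 ⟨?_, rfl, fun s hs => ?_⟩⟩
  · filter_upwards [hN] with n hn
    rw [hj n hn]
    exact (hi n hn).1
  · filter_upwards [hN, hs] with n hn hsn
    rw [hj n hn]
    exact (hi n hn).2 _ hsn

variable {N}

theorem IsOperatingPoint.unique {i v i' v' : BranchVector F G} (h : IsOperatingPoint N i v)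
    (h' : IsOperatingPoint N i' v') : i = i' ∧ v = v' := by
  induction i using Quotient.inductionOn with | _ i => ?_
  induction i' using Quotient.inductionOn with | _ i' => ?_
  obtain ⟨hi, rfl, ht⟩ := (isOperatingPoint_mk_iff N).1 h
  obtain ⟨hi', rfl, ht'⟩ := (isOperatingPoint_mk_iff N).1 h'
  -- The single test sequence of differences suffices for both solutions, so only finitely many
  -- large sets of indices are intersected.
  have hs : ∀ᶠ n in (F : Filter ℕ), i n - i' n ∈ (N n).solutionSpace := by
    filter_upwards [hi, hi'] with n hn hn' using (N n).sub_mem_solutionSpace hn hn'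
  have heq : ∀ᶠ n in (F : Filter ℕ), i n = i' n := by
    filter_upwards [hi, hi', ht _ hs, ht' _ hs] with n hn hn' h h'
    exact (N n).eq_of_tellegen hn hn' (h.trans h'.symm)
  refine ⟨Quotient.sound heq, Quotient.sound ?_⟩
  filter_upwards [heq] with n hn
  rw [hn]

theorem hasSum_mk_zero {A : ℕ → Type u} {a : ∀ n, A n → ℝ}
    (h : ∀ᶠ n in (F : Filter ℕ), HasSum (a n) 0) :
    Internal.HasSum (Quotient.mk _ a : (F : Filter ℕ).Product fun n => A n → ℝ) 0 :=
  ⟨h.mono fun _ hn => hn.summable, Filter.Germ.coe_eq.2 (h.mono fun _ hn => hn.tsum_eq)⟩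

theorem IsOperatingPoint.currentLaw {i v : BranchVector F G} (h : IsOperatingPoint N i v)
    {S : (F : Filter ℕ).Product fun n => Set (V n)}
    (hS : Internal.Holds (fun n S => (G n).IsCutSide S ∧ (N n).Restraining S) S) :
    CurrentLaw N i S := by
  induction i using Quotient.inductionOn with | _ i => ?_
  induction S using Quotient.inductionOn with | _ S => ?_
  refine hasSum_mk_zero (a := fun n b => (N n).incidence (S n) b * i n b) ?_
  have hi : ∀ᶠ n in (F : Filter ℕ), i n ∈ (N n).solutionSpace := h.1
  have hS' : ∀ᶠ n in (F : Filter ℕ), (G n).IsCutSide (S n) ∧ (N n).Restraining (S n) := hS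
  filter_upwards [hi, hS'] with n hin hSn using (N n).hasSum_incidence_mul hSn.1 hSn.2 hin

theorem IsOperatingPoint.voltageLaw (hN : ∀ᶠ n in (F : Filter ℕ), (N n).FiniteIsolatedPower)
    {i v : BranchVector F G} (h : IsOperatingPoint N i v)
    {L : (F : Filter ℕ).Product fun n => RawLoop (V n)}
    (hL : Internal.Holds (fun n L => (N n).IsLoop L ∧ (N n).Perceptible L) L) :
    VoltageLaw N v L := by
  induction i using Quotient.inductionOn with | _ i => ?_
  induction L using Quotient.inductionOn with | _ L => ?_
  obtain ⟨hi, rfl, ht⟩ := (isOperatingPoint_mk_iff N).1 h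
  have hL' : ∀ᶠ n in (F : Filter ℕ), (N n).IsLoop (L n) ∧ (N n).Perceptible (L n) := hL
  refine hasSum_mk_zero
    (a := fun n b => (N n).loopCurrent (L n) b * ((N n).r b * i n b - (N n).e b)) ?_
  filter_upwards [hN, hi, hL', ht (fun n => (N n).loopCurrent (L n)) (hL'.mono fun n hn =>
    (N n).mem_solutionSpace_of_mem_loopSpan (Submodule.subset_span ⟨L n, hn.1, hn.2, rfl⟩))]
    with n hNn hin hLn htn
  exact (N n).hasSum_loopCurrent_mul_voltage hNn hin hLn.1 hLn.2 htn

end Nonstandard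

theorem mainTheorem2 {V : ℕ → Type u} {ν : ℕ∞} (hν : 1 ≤ ν)
    (F : Ultrafilter ℕ) (hF : (F : Filter ℕ) ≤ Filter.cofinite)
    (G : ∀ n, TransfiniteGraph (V n) ν) (N : ∀ n, ResistiveNetwork (G n))
    (hN : ∀ᶠ n in (F : Filter ℕ), (N n).FiniteIsolatedPower) :
    -- the hyperreal operating point exists and is unique
    (∃! p : Nonstandard.BranchVector F G × Nonstandard.BranchVector F G,
      Nonstandard.IsOperatingPoint N p.1 p.2) ∧
    ∀ i v : Nonstandard.BranchVector F G, Nonstandard.IsOperatingPoint N i v →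
      -- current law at restraining maximal nonstandard 0-nodes
      (∀ x : (F : Filter ℕ).Product V,
        Internal.Holds (fun n x => (G n).rank x = 0 ∧ (G n).IsMaximal x) x →
        Internal.Holds (fun n x => (N n).Restraining {x}) x →
        Nonstandard.CurrentLaw N i (Internal.map (fun _ x => {x}) x)) ∧
      -- current law at nonstandard nodes of positive rank, for restraining cuts around them
      (∀ μ : ℕ∞, 1 ≤ μ → μ ≤ ν → ∀ x : Nonstandard.Node F G μ,
        ∀ S : (F : Filter ℕ).Product fun n => Set (V n),
        Internal.Holds (fun n S => (G n).IsCutSide S ∧ (N n).Restraining S) S →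
        Internal.Holds₂ (fun _ x S => x ∈ S) (Nonstandard.Node.toInternal F G x) S →
        Nonstandard.CurrentLaw N i S) ∧
      -- voltage law around perceptible nonstandard loops of ranks up to `ν`
      (∀ L : (F : Filter ℕ).Product fun n => RawLoop (V n),
        Internal.Holds (fun n L => (N n).IsLoop L ∧ (N n).Perceptible L) L →
        Nonstandard.VoltageLaw N v L) := by
  refine ⟨?_, fun i v h => ⟨fun x hx hr => h.currentLaw ?_, fun μ _ _ x S hS _ => h.currentLaw hS,
    fun L hL => h.voltageLaw hN hL⟩⟩
  · obtain ⟨i, v, h⟩ := Nonstandard.exists_isOperatingPoint N hN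
    exact ⟨(i, v), h, fun p hp => Prod.ext (hp.unique h).1 (hp.unique h).2⟩
  · induction x using Quotient.inductionOn
    exact (hx.and hr).mono fun n hn =>
      ⟨TransfiniteGraph.isCutSide_singleton hn.1.1 hn.1.2, hn.2⟩
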